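/- **Setting.** Let $S^1$ be the set $[0,\infty)$ with the topology consisting of the usual open subsets of $(0,\infty)$ and of the usual open subsets of $[0,\infty)$ that contain $0$ and a half-line $(A,\infty)$, $A>0$ (a circle). A *marked partition* is a pair $x=(\pi,\mathbf v)$, where $\pi$ is a partition of $\mathbb N=\{1,2,\dots\}$ and $\mathbf v=(v_i)_{i\ge1}\in (S^1)^{\mathbb N}$ is constant on each block of $\pi$; the common value on a block is its mark. It is *non-degenerate* if every finite block has mark $0$. The set of partitions of $\mathbb N$ carries the metric $d(\pi,\pi')=\big(\sup\{n:\pi|_{[n]}=\pi'|_{[n]}\}\big)^{-1}$ (with $(\sup\mathbb N)^{-1}=0$), and the space $\mathcal M_\infty^\star$ of non-degenerate marked partitions carries the trace of the product topology and its Borel $\sigma$-algebra. For a permutation $\sigma$ of $\mathbb N$ with finite support, $x^\sigma=(\pi^\sigma,(v_{\sigma(i)})_i)$, where $i$ and $j$ are in the same block of $\pi^\sigma$ iff $\sigma(i)$ and $\sigma(j)$ are in the same block of $\pi$. A random variable $X$ with values in $\mathcal M_\infty^\star$ is *exchangeable* if $X^\sigma$ has the same law as $X$ for every such $\sigma$.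 Let $\preceq$ be the lexicographic order on $[0,1]\times[0,\infty)$, and let $$\mathcal Z^\downarrow=\Big\{\mathbf z=(s_k,v_k)_{k\ge1}\in([0,1]\times[0,\infty))^{\mathbb N}:\ (s_1,v_1)\succeq(s_2,v_2)\succeq\cdots,\ \sum_k s_k\le1,\ \text{and } v_k=0 \text{ whenever } s_k=0\Big\},$$ with the product topology and its Borel $\sigma$-algebra. For $\mathbf z\in\mathcal Z^\downarrow$, let $t_n=\sum_{k\le n}s_k$ and let $(U_i)_{i\ge1}$ be i.i.d. uniform on $[0,1]$. The *marked paintbox law* $\rho_{\mathbf z}$ is the law on $\mathcal M_\infty^\star$ of the (almost surely non-degenerate) marked partition in which $i$ and $j$ are in the same block iff $i=j$ or $U_i,U_j\in[t_{n-1},t_n)$ for some $n\ge1$, and in which the mark of $i$ is $v_n$ if $U_i\in[t_{n-1},t_n)$, and $0$ if $U_i\ge\sum_k s_k$. A marked partition $x$ *has asymptotic frequencies* if $|B|=\lim_{n}\#(B\cap[n])/n$ exists for every block $B$. In that case $|x|^\downarrow\in\mathcal Z^\downarrow$ is the $\preceq$-nonincreasing reordering of the pairs $(|B|,\text{mark of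 }B)$ over the blocks $B$ with $|B|>0$, completed by terms $(0,0)$ if there are only finitely many such blocks. **Proposition.** Let $X$ be an exchangeable random variable with values in $\mathcal M_\infty^\star$. Then $\mathbf z\mapsto\rho_{\mathbf z}$ is measurable, $X$ has asymptotic frequencies almost surely, $|X|^\downarrow$ is (almost surely equal to) a random variable with values in $\mathcal Z^\downarrow$, and there exists a unique probability measure $\nu$ on $\mathcal Z^\downarrow$ such that $$\mathbb P(X\in\cdot)=\int_{\mathcal Z^\downarrow}\rho_{\mathbf z}(\cdot)\,\nu(\mathrm d\mathbf z).$$ Moreover, $\nu$ is the law of $|X|^\downarrow$. -/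

import Mathlib

open MeasureTheory Filter Topology
open scoped NNReal

/-! ### The space of marks -/

/-- The space of marks: the set `[0, ∞)`, with the topology (defined below) that identifies
`0` with `∞`. -/
@[ext]
structure Mark where
  /-- the representative in `[0, ∞)` -/
  val : ℝ≥0

namespace Mark

instance : Zero Mark := ⟨⟨0⟩⟩

/-- The open sets are the usual open sets of `(0, ∞)`, and the usual open sets of `[0, ∞)` that
contain `0` and a half-line `(A, ∞)`. -/
instance : TopologicalSpace Mark where
  IsOpen U := IsOpen {v : ℝ≥0 | (⟨v⟩ : Mark) ∈ U} ∧
    ((0 : Mark) ∈ U → ∃ A : ℝ≥0, 0 < A ∧ ∀ v : ℝ≥0, A < v → (⟨v⟩ : Mark) ∈ U)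
  isOpen_univ := ⟨by simp, fun _ => ⟨1, one_pos, fun _ _ => trivial⟩⟩
  isOpen_inter := by
    rintro U V ⟨hU, hU'⟩ ⟨hV, hV'⟩
    refine ⟨hU.inter hV, fun h => ?_⟩
    obtain ⟨A, hA, hA'⟩ := hU' h.1
    obtain ⟨B, hB, hB'⟩ := hV' h.2
    exact ⟨max A B, lt_max_of_lt_left hA, fun v hv =>
      ⟨hA' v ((le_max_left _ _).trans_lt hv), hB' v ((le_max_right _ _).trans_lt hv)⟩⟩
  isOpen_sUnion := by
    intro S hS
    constructor
    · have h : {v : ℝ≥0 | (⟨v⟩ : Mark) ∈ ⋃₀ S} = ⋃ U ∈ S, {v : ℝ≥0 | (⟨v⟩ : Mark) ∈ U} := by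
        ext v; simp
      rw [h]
      exact isOpen_biUnion fun U hU => (hS U hU).1
    · rintro ⟨U, hU, h0⟩
      obtain ⟨A, hA, hA'⟩ := (hS U hU).2 h0
      exact ⟨A, hA, fun v hv => ⟨U, hU, hA' v hv⟩⟩

instance : MeasurableSpace Mark := borel Mark

instance : BorelSpace Mark := ⟨rfl⟩

end Mark

/-! ### Partitions of the positive integers

A partition of `{1, 2, …}` is an equivalence relation; the natural number `i` stands for the
integer `i + 1`, so that `[n] = {1, …, n}` corresponds to `{i | i < n}`. -/

/-- Two partitions have the same restriction to `[n]`. -/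
def AgreeOn (n : ℕ) (π π' : Setoid ℕ) : Prop :=
  ∀ i j : ℕ, i < n → j < n → (π i j ↔ π' i j)

/-- The topology of the metric `d(π, π') = (sup {n | π and π' have the same restriction to [n]})⁻¹`:
the sets `{π' | AgreeOn n π π'}` are the balls around `π`. -/
instance : TopologicalSpace (Setoid ℕ) where
  IsOpen U := ∀ π ∈ U, ∃ n : ℕ, ∀ π' : Setoid ℕ, AgreeOn n π π' → π' ∈ U
  isOpen_univ := fun _ _ => ⟨0, fun _ _ => trivial⟩
  isOpen_inter := by
    intro U V hU hV π hπ
    obtain ⟨n, hn⟩ := hU π hπ.1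
    obtain ⟨m, hm⟩ := hV π hπ.2
    exact ⟨max n m, fun π' h =>
      ⟨hn π' fun i j hi hj => h i j (lt_max_of_lt_left hi) (lt_max_of_lt_left hj),
        hm π' fun i j hi hj => h i j (lt_max_of_lt_right hi) (lt_max_of_lt_right hj)⟩⟩
  isOpen_sUnion := by
    rintro S hS π ⟨U, hU, hπ⟩
    obtain ⟨n, hn⟩ := hS U hU π hπ
    exact ⟨n, fun π' h => ⟨U, hU, hn π' h⟩⟩

instance : MeasurableSpace (Setoid ℕ) := borel (Setoid ℕ)

instance : BorelSpace (Setoid ℕ) := ⟨rfl⟩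

/-! ### Marked partitions -/

/-- Marked partitions: pairs of a partition and a sequence of marks that is constant on the
blocks. The σ-algebra is the trace of the product of the Borel σ-algebras (all the spaces are
second countable, so it is the Borel σ-algebra of the trace of the product topology). -/
abbrev MarkedPartition : Type :=
  {x : Setoid ℕ × (ℕ → Mark) // ∀ i j : ℕ, x.1 i j → x.2 i = x.2 j}

namespace MarkedPartition

/-- The partition underlying a marked partition. -/
def part (x : MarkedPartition) : Setoid ℕ := x.1.1

/-- The mark of (the block of) `i`. -/
def mark (x : MarkedPartition) (i : ℕ) : Mark := x.1.2 i

/-- Every element of a finite block has mark `0`. -/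
def NonDegenerate (x : MarkedPartition) : Prop :=
  ∀ i : ℕ, {j : ℕ | x.part i j}.Finite → x.mark i = 0

/-- The action `x ↦ x^σ`: `i` and `j` are in the same block of `x^σ` iff `σ i` and `σ j` are in
the same block of `x`, and the mark of `i` in `x^σ` is the mark of `σ i` in `x`. -/
def act (σ : Equiv.Perm ℕ) (x : MarkedPartition) : MarkedPartition :=
  ⟨(Setoid.comap σ x.part, fun i => x.mark (σ i)), fun i j h => x.2 (σ i) (σ j) h⟩

theorem NonDegenerate.act {x : MarkedPartition} (hx : x.NonDegenerate) (σ : Equiv.Perm ℕ) :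
    (x.act σ).NonDegenerate := by
  intro i hi
  refine hx (σ i) ?_
  refine (hi.image σ).subset fun j hj => ?_
  refine ⟨σ.symm j, ?_, by simp⟩
  change x.part (σ i) (σ (σ.symm j))
  simpa using hj

end MarkedPartition

/-- The space of non-degenerate marked partitions. -/
abbrev NonDegPartition : Type := {x : MarkedPartition // x.NonDegenerate}

/-- The action of permutations on non-degenerate marked partitions. -/
def NonDegPartition.act (σ : Equiv.Perm ℕ) (x : NonDegPartition) : NonDegPartition :=
  ⟨x.1.act σ, x.2.act σ⟩

/-- A random non-degenerate marked partition `X` is exchangeable if `X^σ` and `X` have the same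
law for every permutation `σ` with finite support. -/
def Exchangeable {Ω : Type*} [MeasurableSpace Ω] (P : Measure Ω) (X : Ω → NonDegPartition) : Prop :=
  ∀ σ : Equiv.Perm ℕ, {n : ℕ | σ n ≠ n}.Finite →
    P.map (fun ω => (X ω).act σ) = P.map X

/-! ### Ranked sequences of frequencies with marks -/

/-- The space `𝒵↓` of sequences `z_k = (s_k, v_k)` in `[0, 1] × [0, ∞)` that are nonincreasing in
the lexicographic order, with `∑ s_k ≤ 1`, and with `v_k = 0` whenever `s_k = 0`. The index `k`
starts from `0`. -/
abbrev RankedSeq : Type :=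
  {z : ℕ → ℝ × ℝ≥0 //
    (∀ k, (z k).1 ∈ Set.Icc (0 : ℝ) 1) ∧
    Antitone (fun k => toLex (z k)) ∧
    Summable (fun k => (z k).1) ∧ ∑' k, (z k).1 ≤ 1 ∧
    ∀ k, (z k).1 = 0 → (z k).2 = 0}

namespace RankedSeq

/-- The mass `s_k`. -/
def s (z : RankedSeq) (k : ℕ) : ℝ := (z.1 k).1

/-- The mark `v_k`. -/
def v (z : RankedSeq) (k : ℕ) : Mark := ⟨(z.1 k).2⟩

/-- The sequence all of whose terms are `(0, 0)`. -/
def zero : RankedSeq := ⟨fun _ => (0, 0), by simp [antitone_const]⟩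

/-- The partial sums `s_0 + … + s_{n-1}`. -/
def t (z : RankedSeq) (n : ℕ) : ℝ := ∑ k ∈ Finset.range n, z.s k

theorem t_mono (z : RankedSeq) : Monotone z.t :=
  monotone_nat_of_le_succ fun n => by
    have h : 0 ≤ z.s n := (z.2.1 n).1
    simp only [t, Finset.sum_range_succ]
    linarith

/-- The interval `[s_0 + … + s_{n-1}, s_0 + … + s_n)` of length `s_n`. -/
def box (z : RankedSeq) (n : ℕ) : Set ℝ := Set.Ico (z.t n) (z.t (n + 1))

theorem box_unique (z : RankedSeq) {u : ℝ} {n m : ℕ} (hn : u ∈ z.box n) (hm : u ∈ z.box m) :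
    n = m := by
  have key : ∀ {a b : ℕ}, u ∈ z.box a → u ∈ z.box b → ¬ a < b := fun ha hb hab =>
    absurd (ha.2.trans_le ((z.t_mono hab).trans hb.1)) (lt_irrefl _)
  exact le_antisymm (not_lt.1 (key hm hn)) (not_lt.1 (key hn hm))

/-! ### Paintboxes -/

/-- The partition painted by the points `u_0, u_1, …`: two distinct integers `i` and `j` are in the
same block iff `u_i` and `u_j` fall in the same interval. -/
def paintPart (z : RankedSeq) (u : ℕ → unitInterval) : Setoid ℕ where
  r i j := i = j ∨ ∃ n, (u i : ℝ) ∈ z.box n ∧ (u j : ℝ) ∈ z.box n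
  iseqv :=
    { refl := fun _ => Or.inl rfl
      symm := by
        rintro i j (h | ⟨n, hi, hj⟩)
        · exact Or.inl h.symm
        · exact Or.inr ⟨n, hj, hi⟩
      trans := by
        rintro i j k (rfl | ⟨n, hi, hj⟩) (rfl | ⟨m, hj', hk⟩)
        · exact Or.inl rfl
        · exact Or.inr ⟨m, hj', hk⟩
        · exact Or.inr ⟨n, hi, hj⟩
        · obtain rfl := z.box_unique hj hj'
          exact Or.inr ⟨n, hi, hk⟩ }

open Classical in
/-- The mark painted at a point `u` of `[0, 1]`: it is `v_n` if `u` is in the `n`-th interval, and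
`0` if `u` is in none of the intervals, that is if `∑ s_k ≤ u`. -/
noncomputable def paintMark (z : RankedSeq) (u : unitInterval) : Mark :=
  if h : ∃ n, (u : ℝ) ∈ z.box n then z.v (Nat.find h) else 0

theorem paintMark_of_mem (z : RankedSeq) {u : unitInterval} {n : ℕ} (hn : (u : ℝ) ∈ z.box n) :
    z.paintMark u = z.v n := by
  classical
  have h : ∃ n, (u : ℝ) ∈ z.box n := ⟨n, hn⟩
  rw [paintMark, dif_pos h, z.box_unique (Nat.find_spec h) hn]

/-- The marked partition painted by the points `u_0, u_1, …`. -/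
noncomputable def paint (z : RankedSeq) (u : ℕ → unitInterval) : MarkedPartition :=
  ⟨(z.paintPart u, fun i => z.paintMark (u i)), by
    rintro i j (rfl | ⟨n, hi, hj⟩)
    · rfl
    · exact (z.paintMark_of_mem hi).trans (z.paintMark_of_mem hj).symm⟩

/-- The paintbox law `ρ_z`: the law of the marked partition painted by i.i.d. uniform points
of `[0, 1]`. This marked partition is almost surely non-degenerate, and its law is regarded as a
measure on the (measurable) subspace of non-degenerate marked partitions. -/
noncomputable def paintboxLaw (z : RankedSeq) : Measure NonDegPartition :=
  ((Measure.infinitePi fun _ : ℕ => (volume : Measure unitInterval)).map z.paint).comap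
    Subtype.val

end RankedSeq

/-! ### Asymptotic frequencies -/

/-- The set `B` has asymptotic frequency `a`: `#(B ∩ [n]) / n` converges to `a`. -/
def HasFreq (B : Set ℕ) (a : ℝ) : Prop :=
  Tendsto (fun n : ℕ => ((B ∩ Set.Iio n).ncard : ℝ) / n) atTop (𝓝 a)

namespace MarkedPartition

/-- Every block has an asymptotic frequency. -/
def HasAsymptoticFreqs (x : MarkedPartition) : Prop :=
  ∀ B ∈ x.part.classes, ∃ a : ℝ, HasFreq B a

/-- The sequence `z` is the nonincreasing reordering of the family of pairs (frequency, mark) of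
the blocks of `x` with a positive frequency, completed by terms `(0, 0)`: there is a
one-to-one correspondence between the indices `k` with `s_k > 0` and these blocks such that
`s_k` and `v_k` are the frequency and the mark of the block that corresponds to `k`. -/
def IsRanking (x : MarkedPartition) (z : RankedSeq) : Prop :=
  ∃ e : {k : ℕ // 0 < z.s k} ≃ {B : Set ℕ // B ∈ x.part.classes ∧ ∃ a : ℝ, 0 < a ∧ HasFreq B a},
    ∀ k, HasFreq (e k).1 (z.s k) ∧ ∀ i ∈ (e k).1, x.mark i = z.v k

open Classical in
/-- The ranked sequence `|x|↓` of a marked partition that has asymptotic frequencies (and, by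
convention, the zero sequence for the other marked partitions). -/
noncomputable def ranked (x : MarkedPartition) : RankedSeq :=
  if h : x.HasAsymptoticFreqs ∧ ∃ z, x.IsRanking z then h.2.choose else RankedSeq.zero

end MarkedPartition

/-! The proof samples a realization `x` at random integers. Draw `u 0, u 1, …` independently and
uniformly on `{0, …, N}` and read `x` along `u`. If the first `n` draws are distinct, they extend to
a permutation with finite support, so by exchangeability the sampled marked partition, seen on `n`
points, has the law of `X` (`measure_sampleEvent_of_injOn`). Collisions have probability at most `n²
/ (N + 1)`.

For fixed `x`, on the other hand, the sample is itself a paintbox: its boxes are the blocks of `x`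
with several elements, and their masses are the proportions of these blocks in `{0, …, N}`. The
probability of a test event is then a finite product of sums `∑ 1{mark allowed} · mass ^ m`
(`infinitePi_boxEvent`). As `N → ∞` the masses tend to the asymptotic frequencies, and the product
tends to the same expression for the paintbox directed by `|x|↓` (`Regular.tendsto_sampleLaw`).
Integrating over `x` identifies the law of `X` with the mixture on a generating π-system
(`lintegral_paintboxLaw_ranked`).

Two facts about typical realizations are needed. Frequencies exist by an L² law of large numbers,
which uses only that the second moments of the indicators are those of an exchangeable sequence
(`ae_exists_tendsto_average`). Moreover no mass may escape in the sums with `m = 1`: the density of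
singletons must be exactly one minus the sum of the frequencies (`ae_regular`). One inequality is
Fatou. The other holds in expectation, because a block of frequency zero is almost surely a
singleton (`ae_isSingleton`), and together they give equality almost surely.

Uniqueness holds because `z` can be read off a realization of its paintbox: by the strong law, `|x|↓
= z` for almost every `x` under `ρ_z` (`ae_paintboxLaw`). The pushforward of a mixture by the
ranking is therefore the mixing measure. -/

/-! ### Measurability of marks, partitions and marked partitions. -/

theorem Mark.continuous_mk : Continuous Mark.mk :=
  ⟨fun _ hU => hU.1⟩

theorem Mark.measurable_mk : Measurable Mark.mk :=
  Mark.continuous_mk.measurable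

theorem Mark.isClosed_singleton_zero : IsClosed ({0} : Set Mark) := by
  rw [← isOpen_compl_iff]
  refine ⟨?_, fun h => absurd rfl h⟩
  have : {v : ℝ≥0 | (⟨v⟩ : Mark) ∈ ({0} : Set Mark)ᶜ} = {0}ᶜ := by
    ext v
    exact not_congr ⟨fun h => congrArg Mark.val h, fun h => congrArg Mark.mk h⟩
  rw [this]
  exact isOpen_compl_singleton

/-- Continuity fails at `0`, whose neighbourhoods contain a half-line, but away from the closed
point `0` the topology is the usual one. The preimage of an open set is thus an open set, up to
adding the closed singleton `{0}`. -/
theorem Mark.measurable_val : Measurable Mark.val := by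
  refine measurable_of_isOpen fun U hU => ?_
  have h1 : IsOpen (Mark.val ⁻¹' (U \ {0})) := by
    refine ⟨hU.sdiff isClosed_singleton, fun h => absurd rfl h.2⟩
  have h0 : MeasurableSet ({0} : Set Mark) := Mark.isClosed_singleton_zero.measurableSet
  by_cases h : (0 : ℝ≥0) ∈ U
  · have : Mark.val ⁻¹' U = Mark.val ⁻¹' (U \ {0}) ∪ {0} := by
      ext v
      by_cases hv : v.val = 0
      · have : v = 0 := Mark.ext hv
        simp only [this, Set.mem_preimage, Set.union_singleton, Set.mem_insert_iff, true_or,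
          iff_true]
        exact h
      · have : v ≠ 0 := fun h => hv (congrArg Mark.val h)
        simp [hv, this]
    rw [this]
    exact h1.measurableSet.union h0
  · have : Mark.val ⁻¹' U = Mark.val ⁻¹' (U \ {0}) := by
      rw [Set.sdiff_singleton_eq_self h]
    rw [this]
    exact h1.measurableSet

theorem Setoid.measurableSet_rel (i j : ℕ) : MeasurableSet {π : Setoid ℕ | π i j} := by
  refine IsOpen.measurableSet (fun π hπ => ⟨max i j + 1, fun π' h => ?_⟩)
  exact (h i j (by omega) (by omega)).1 hπ

/-- For each `n` there are finitely many restrictions to `[n]`, so every open set is a countable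
union of cylinders, each given by finitely many relations. -/
theorem measurable_setoid {Ω : Type*} [MeasurableSpace Ω] {f : Ω → Setoid ℕ}
    (hf : ∀ i j, MeasurableSet {ω | f ω i j}) : Measurable f := by
  classical
  refine measurable_of_isOpen fun U hU => ?_
  have key : f ⁻¹' U = ⋃ n : ℕ, ⋃ p : Finset (Fin n × Fin n),
      ⋃ _ : {π : Setoid ℕ | ∀ i j : Fin n, π i j ↔ (i, j) ∈ p} ⊆ U,
      {ω | ∀ i j : Fin n, f ω i j ↔ (i, j) ∈ p} := by
    ext ω
    simp only [Set.mem_preimage, Set.mem_iUnion, Set.mem_ofPred_eq]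
    constructor
    · intro h
      obtain ⟨n, hn⟩ := hU _ h
      refine ⟨n, Finset.univ.filter fun q => f ω q.1 q.2, ?_, by simp⟩
      intro π hπ
      refine hn π fun i j hi hj => ?_
      simpa using (hπ ⟨i, hi⟩ ⟨j, hj⟩).symm
    · rintro ⟨n, p, hp, hω⟩
      exact hp hω
  rw [key]
  refine .iUnion fun n => .iUnion fun p => .iUnion fun _ => ?_
  simp only [Set.ofPred_forall]
  refine .iInter fun i => .iInter fun j => ?_
  by_cases h : (i, j) ∈ p
  · simpa [h] using hf i j
  · simp only [h, iff_false]
    exact (hf i j).compl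

namespace MarkedPartition

theorem measurableSet_part (i j : ℕ) : MeasurableSet {x : MarkedPartition | x.part i j} :=
  (measurable_fst.comp measurable_subtype_coe) (Setoid.measurableSet_rel i j)

theorem measurable_mark (i : ℕ) : Measurable fun x : MarkedPartition => x.mark i :=
  (measurable_pi_apply i).comp (measurable_snd.comp measurable_subtype_coe)

theorem measurable_of {Ω : Type*} [MeasurableSpace Ω] {f : Ω → MarkedPartition}
    (h1 : ∀ i j, MeasurableSet {ω | (f ω).part i j})
    (h2 : ∀ i, Measurable fun ω => (f ω).mark i) : Measurable f :=
  Measurable.subtype_mk (f := fun ω => (f ω).1)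
    ((measurable_setoid h1).prodMk (measurable_pi_iff.2 h2))

theorem measurable_act (σ : Equiv.Perm ℕ) : Measurable (act σ) :=
  measurable_of (fun i j => measurableSet_part (σ i) (σ j)) fun i => measurable_mark (σ i)

theorem measurableSet_nonDegenerate : MeasurableSet {x : MarkedPartition | x.NonDegenerate} := by
  have : {x : MarkedPartition | x.NonDegenerate} =
      ⋂ i : ℕ, ((⋃ n : ℕ, ⋂ j : ℕ, ⋂ _ : n ≤ j, {x | x.part i j}ᶜ)ᶜ ∪
        {x | x.mark i ∈ ({0} : Set Mark)}) := by
    ext x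
    simp only [NonDegenerate, Set.mem_ofPred_eq, Set.mem_iInter, Set.mem_union, Set.mem_compl_iff,
      Set.mem_iUnion, Set.mem_singleton_iff]
    refine forall_congr' fun i => ?_
    rw [← imp_iff_not_or]
    refine imp_congr ⟨fun h => ?_, ?_⟩ Iff.rfl
    · obtain ⟨n, hn⟩ := h.bddAbove
      exact ⟨n + 1, fun j hj hx => by have := hn hx; omega⟩
    · rintro ⟨n, hn⟩
      refine (Set.finite_Iio n).subset fun j hj => ?_
      by_contra h
      exact hn j (not_lt.1 h) hj
  rw [this]
  refine .iInter fun i => .union (.compl (.iUnion fun n => .iInter fun j => .iInter fun _ =>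
    (measurableSet_part i j).compl)) ?_
  exact measurable_mark i Mark.isClosed_singleton_zero.measurableSet

end MarkedPartition

namespace NonDegPartition

theorem measurableSet_part (i j : ℕ) : MeasurableSet {x : NonDegPartition | x.1.part i j} :=
  measurable_subtype_coe (MarkedPartition.measurableSet_part i j)

theorem measurable_mark (i : ℕ) : Measurable fun x : NonDegPartition => x.1.mark i :=
  (MarkedPartition.measurable_mark i).comp measurable_subtype_coe

theorem measurable_act (σ : Equiv.Perm ℕ) : Measurable (act σ) :=
  Measurable.subtype_mk ((MarkedPartition.measurable_act σ).comp measurable_subtype_coe)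

end NonDegPartition

/-! ### A generating π-system of test events. -/

/-- The partition whose only block with more than one element is `{i | i < n}`. -/
def initialSetoid (n : ℕ) : Setoid ℕ where
  r i j := i = j ∨ (i < n ∧ j < n)
  iseqv := ⟨fun _ => Or.inl rfl, by grind, by grind⟩

/-- The event that a marked partition is coarser than `E` and has its marks in the sets `C i`. -/
def cylinderEvent (E : Setoid ℕ) (C : ℕ → Set Mark) : Set MarkedPartition :=
  {x | E ≤ x.part ∧ ∀ i, x.mark i ∈ C i}

/-- The parameters of the events `cylinderEvent E C` that determine the law of a random marked
partition. -/
structure AdmissibleCylinder (n : ℕ) (E : Setoid ℕ) (C : ℕ → Set Mark) : Prop where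
  le : E ≤ initialSetoid n
  eq_univ : ∀ i, n ≤ i → C i = Set.univ
  measurableSet : ∀ i, MeasurableSet (C i)
  zero_notMem : ∀ i, (0 : Mark) ∈ C i → C i = Set.univ

theorem measurableSet_cylinderEvent {n : ℕ} {E : Setoid ℕ} {C : ℕ → Set Mark}
    (h : AdmissibleCylinder n E C) : MeasurableSet (cylinderEvent E C) := by
  have : cylinderEvent E C = (⋂ i : ℕ, ⋂ j : ℕ, ⋂ _ : E i j, {x | x.part i j}) ∩
      ⋂ i, {x | x.mark i ∈ C i} := by
    ext x
    simp [cylinderEvent, Setoid.le_def]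
  rw [this]
  exact .inter (.iInter fun i => .iInter fun j => .iInter fun _ =>
    MarkedPartition.measurableSet_part i j)
    (.iInter fun i => MarkedPartition.measurable_mark i (h.measurableSet i))

/-- The collection of the cylinder events in the space of non-degenerate marked partitions. -/
def cylinderEvents : Set (Set NonDegPartition) :=
  {D | ∃ n E C, AdmissibleCylinder n E C ∧ D = Subtype.val ⁻¹' cylinderEvent E C}

theorem initialSetoid_mono {m n : ℕ} (h : m ≤ n) : initialSetoid m ≤ initialSetoid n := by
  rintro i j (h1 | h1)
  · exact Or.inl h1
  · exact Or.inr ⟨h1.1.trans_le h, h1.2.trans_le h⟩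

/-- Being coarser than two partitions means being coarser than their join, and an intersection of
mark sets contains `0` only if both sets are the whole space. -/
theorem isPiSystem_cylinderEvents : IsPiSystem cylinderEvents := by
  rintro _ ⟨n, E, C, h, rfl⟩ _ ⟨n', E', C', h', rfl⟩ -
  refine ⟨max n n', E ⊔ E', fun i => C i ∩ C' i, ⟨?_, ?_, ?_, ?_⟩, ?_⟩
  · exact sup_le (h.le.trans (initialSetoid_mono (le_max_left _ _)))
      (h'.le.trans (initialSetoid_mono (le_max_right _ _)))
  · intro i hi
    rw [h.eq_univ i (le_trans (le_max_left _ _) hi), h'.eq_univ i (le_trans (le_max_right _ _) hi),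
      Set.inter_univ]
  · exact fun i => (h.measurableSet i).inter (h'.measurableSet i)
  · rintro i ⟨h1, h2⟩
    rw [h.zero_notMem i h1, h'.zero_notMem i h2, Set.inter_univ]
  · ext x
    simp only [cylinderEvent, Set.mem_inter_iff, Set.mem_preimage, Set.mem_ofPred_eq, sup_le_iff,
      forall_and]
    tauto

/-- It suffices to recover each relation, by testing against the partition that joins only `i` and
`j`, and each single mark. -/
theorem measurableSpace_eq_generateFrom_cylinderEvents :
    (inferInstance : MeasurableSpace NonDegPartition) =
      MeasurableSpace.generateFrom cylinderEvents := by
  refine le_antisymm ?_ (MeasurableSpace.generateFrom_le ?_)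
  · have key : @Measurable _ _ (MeasurableSpace.generateFrom cylinderEvents) _
        (fun x : NonDegPartition => x) := by
      let m : MeasurableSpace NonDegPartition := MeasurableSpace.generateFrom cylinderEvents
      refine @Measurable.subtype_mk _ _ m _ _ (fun x : NonDegPartition => x.1) ?_ fun x => x.2
      refine @MarkedPartition.measurable_of _ m _ (fun i j => ?_) fun i => ?_
      · refine MeasurableSpace.measurableSet_generateFrom
          ⟨max i j + 1, ⟨fun a b => a = b ∨ (a = i ∨ a = j) ∧ (b = i ∨ b = j), fun _ => Or.inl rfl,
            by grind, by grind⟩, fun _ => Set.univ, ⟨?_, by simp, by simp, by simp⟩, ?_⟩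
        · rintro a b (h | h)
          · exact Or.inl h
          · exact Or.inr (by omega)
        · ext x
          simp only [cylinderEvent, Set.mem_preimage, Set.mem_ofPred_eq, Set.mem_univ,
            implies_true, and_true]
          constructor
          · rintro h a b (rfl | ⟨rfl | rfl, rfl | rfl⟩)
            · exact x.1.part.refl' _
            · exact x.1.part.refl' _
            · exact h
            · exact x.1.part.symm' h
            · exact x.1.part.refl' _
          · exact fun h => h (Or.inr ⟨Or.inl rfl, Or.inr rfl⟩)
      · have base : ∀ C : Set Mark, MeasurableSet C → (0 : Mark) ∉ C →
            @MeasurableSet _ m ((fun x : NonDegPartition => x.1.mark i) ⁻¹' C) := by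
          intro C hC h0
          refine MeasurableSpace.measurableSet_generateFrom
            ⟨i + 1, ⊥, fun j => if j = i then C else Set.univ, ⟨bot_le, ?_, ?_, ?_⟩, ?_⟩
          · intro j hj
            rw [if_neg (by omega)]
          · intro j
            split_ifs
            exacts [hC, .univ]
          · intro j
            split_ifs
            exacts [fun h => absurd h h0, fun _ => rfl]
          · ext x
            simp only [cylinderEvent, Set.mem_preimage, Set.mem_ofPred_eq, bot_le, true_and]
            constructor
            · intro h j
              split_ifs with hj
              exacts [hj ▸ h, trivial]
            · intro h
              simpa using h i
        intro C hC
        by_cases h0 : (0 : Mark) ∈ C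
        · have := (base Cᶜ hC.compl (by simpa using h0)).compl
          simpa using this
        · exact base C hC h0
    intro s hs
    exact key hs
  · rintro _ ⟨n, E, C, h, rfl⟩
    exact measurable_subtype_coe (measurableSet_cylinderEvent h)

/-! ### Measurability of the paintbox kernel. -/

namespace RankedSeq

theorem measurable_s (k : ℕ) : Measurable fun z : RankedSeq => z.s k :=
  measurable_fst.comp ((measurable_pi_apply k).comp measurable_subtype_coe)

theorem measurable_v (k : ℕ) : Measurable fun z : RankedSeq => z.v k :=
  Mark.measurable_mk.comp
    (measurable_snd.comp ((measurable_pi_apply k).comp measurable_subtype_coe))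

theorem measurable_t (n : ℕ) : Measurable fun z : RankedSeq => z.t n :=
  Finset.measurable_sum _ fun k _ => measurable_s k

theorem measurableSet_mem_box (n i : ℕ) :
    MeasurableSet {p : RankedSeq × (ℕ → unitInterval) | (p.2 i : ℝ) ∈ p.1.box n} := by
  have hu : Measurable fun p : RankedSeq × (ℕ → unitInterval) => (p.2 i : ℝ) :=
    measurable_subtype_coe.comp ((measurable_pi_apply i).comp measurable_snd)
  exact (measurableSet_le ((measurable_t n).comp measurable_fst) hu).inter
    (measurableSet_lt hu ((measurable_t (n + 1)).comp measurable_fst))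

theorem measurable_paint :
    Measurable fun p : RankedSeq × (ℕ → unitInterval) => p.1.paint p.2 := by
  refine MarkedPartition.measurable_of (fun i j => ?_) fun i => ?_
  · have : {p : RankedSeq × (ℕ → unitInterval) | (p.1.paint p.2).part i j} =
        {_p | i = j} ∪ ⋃ n, ({p | (p.2 i : ℝ) ∈ p.1.box n} ∩ {p | (p.2 j : ℝ) ∈ p.1.box n}) := by
      ext p
      simp only [Set.mem_union, Set.mem_iUnion, Set.mem_inter_iff, Set.mem_ofPred_eq]
      rfl
    rw [this]
    exact (MeasurableSet.const _).union
      (.iUnion fun n => (measurableSet_mem_box n i).inter (measurableSet_mem_box n j))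
  · intro C hC
    have : (fun p : RankedSeq × (ℕ → unitInterval) => (p.1.paint p.2).mark i) ⁻¹' C =
        (⋃ n, ({p | (p.2 i : ℝ) ∈ p.1.box n} ∩ {p | p.1.v n ∈ C})) ∪
        ({p | ∀ n, (p.2 i : ℝ) ∉ p.1.box n} ∩ {_p | (0 : Mark) ∈ C}) := by
      ext p
      change p.1.paintMark (p.2 i) ∈ C ↔ _
      simp only [Set.mem_union, Set.mem_iUnion, Set.mem_inter_iff, Set.mem_ofPred_eq]
      by_cases h : ∃ n, (p.2 i : ℝ) ∈ p.1.box n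
      · obtain ⟨n, hn⟩ := h
        rw [paintMark_of_mem _ hn]
        constructor
        · exact fun h => Or.inl ⟨n, hn, h⟩
        · rintro (⟨m, hm, h⟩ | ⟨h, -⟩)
          · exact box_unique _ hn hm ▸ h
          · exact absurd hn (h n)
      · rw [paintMark, dif_neg h]
        push Not at h
        simp [h]
    rw [this]
    refine .union (.iUnion fun n => (measurableSet_mem_box n i).inter
      ((measurable_v n).comp measurable_fst hC)) (.inter ?_ (.const _))
    simp only [Set.ofPred_forall]
    exact .iInter fun n => (measurableSet_mem_box n i).compl

theorem measurable_paint_right (z : RankedSeq) : Measurable z.paint :=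
  measurable_paint.comp measurable_prodMk_left

theorem paintboxLaw_apply (z : RankedSeq) {A : Set NonDegPartition} (hA : MeasurableSet A) :
    z.paintboxLaw A = (Measure.infinitePi fun _ : ℕ => (volume : Measure unitInterval))
      {u | z.paint u ∈ Subtype.val '' A} := by
  have hi : MeasurableSet (Subtype.val '' A) :=
    MarkedPartition.measurableSet_nonDegenerate.subtype_image hA
  refine (Measure.comap_apply Subtype.val Subtype.val_injective
    (fun s hs => MarkedPartition.measurableSet_nonDegenerate.subtype_image hs) _ hA).trans ?_
  exact Measure.map_apply z.measurable_paint_right hi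

theorem measurable_paintboxLaw : Measurable paintboxLaw := by
  refine Measure.measurable_of_measurable_coe _ fun A hA => ?_
  simp_rw [paintboxLaw_apply _ hA]
  have hi : MeasurableSet (Subtype.val '' A) :=
    MarkedPartition.measurableSet_nonDegenerate.subtype_image hA
  exact measurable_measure_prodMk_left (measurable_paint hi)

end RankedSeq

/-! ### The ranking of the blocks: existence, uniqueness, measurability. -/

/-- In a linear order all of whose upper rays are finite, the elements can be ranked from the
largest to the smallest. -/
theorem exists_rank {I β : Type*} [LinearOrder β] (q : I → β) (hq : Function.Injective q)
    (hfin : ∀ i, {j | q i < q j}.Finite) :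
    ∃ r : I → ℕ, (∀ i j, q i < q j → r j < r i) ∧ ∀ i n, n ≤ r i → ∃ j, r j = n := by
  refine ⟨fun i => {j | q i < q j}.ncard, fun i j hij => ?_, fun i n hn => ?_⟩
  · exact Set.ncard_lt_ncard ⟨fun l hl => hij.trans hl, fun h => lt_irrefl _ (h hij)⟩ (hfin i)
  · change n ≤ {j | q i < q j}.ncard at hn
    -- The rank of `i` is the number of elements above it. The least of these has rank one less, so
    -- one descends until the rank is `n`.
    induction h : {j | q i < q j}.ncard - n generalizing i with
    | zero => exact ⟨i, by simp only; omega⟩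
    | succ m ih =>
      have hne : {j | q i < q j}.Nonempty := by
        rw [← Set.ncard_pos (hfin i)]; omega
      obtain ⟨j, hj, hmin⟩ := (hfin i).exists_minimalFor q _ hne
      have hj' : q i < q j := hj
      have : {l | q j < q l} = {l | q i < q l} \ {j} := by
        ext l
        simp only [Set.mem_ofPred_eq, Set.mem_sdiff, Set.mem_singleton_iff]
        constructor
        · exact fun hl => ⟨hj'.trans hl, fun h => lt_irrefl _ (h ▸ hl)⟩
        · rintro ⟨hl, hne⟩
          rcases lt_or_ge (q j) (q l) with h | h
          · exact h
          · exact absurd (hq (le_antisymm h (hmin hl h))) hne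
      have hc : {l | q j < q l}.ncard = {l | q i < q l}.ncard - 1 := by
        rw [this, Set.ncard_sdiff_singleton_of_mem hj]
      exact ih j (by omega) (by omega)

open Classical in
theorem ncard_inter_Iio (B : Set ℕ) (n : ℕ) :
    ((B ∩ Set.Iio n).ncard : ℝ) = ∑ j ∈ Finset.range n, if j ∈ B then 1 else 0 := by
  have : B ∩ Set.Iio n = ((Finset.range n).filter (· ∈ B) : Finset ℕ) := by
    ext j; simp [and_comm]
  rw [this, Set.ncard_coe_finset, Finset.sum_boole]

namespace MarkedPartition

/-- The block that contains `i`. -/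
def block (x : MarkedPartition) (i : ℕ) : Set ℕ := {j | x.part j i}

/-- The proportion of the integers below `n` that are in the block of `i`. -/
noncomputable def ratio (x : MarkedPartition) (i n : ℕ) : ℝ :=
  ((x.block i ∩ Set.Iio n).ncard : ℝ) / n

/-- The asymptotic frequency of the block of `i`. -/
noncomputable def freq (x : MarkedPartition) (i : ℕ) : ℝ := limUnder atTop (x.ratio i)

/-- The integer `i` is the first element of its block. -/
def IsFirst (x : MarkedPartition) (i : ℕ) : Prop := ∀ j < i, ¬ x.part j i

theorem mem_block_self (x : MarkedPartition) (i : ℕ) : i ∈ x.block i := x.part.refl' i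

theorem block_eq {x : MarkedPartition} {i j : ℕ} (h : x.part i j) : x.block i = x.block j := by
  ext k
  exact ⟨fun hk => x.part.trans' hk h, fun hk => x.part.trans' hk (x.part.symm' h)⟩

theorem block_eq_iff {x : MarkedPartition} {i j : ℕ} : x.block i = x.block j ↔ x.part i j :=
  ⟨fun h => (h ▸ x.mem_block_self i : i ∈ x.block j), block_eq⟩

theorem IsFirst.eq {x : MarkedPartition} {i j : ℕ} (hi : x.IsFirst i) (hj : x.IsFirst j)
    (h : x.part i j) : i = j := by
  rcases lt_trichotomy i j with h' | h' | h'
  · exact absurd h (hj i h')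
  · exact h'
  · exact absurd (x.part.symm' h) (hi j h')

theorem exists_isFirst (x : MarkedPartition) (i : ℕ) : ∃ j, x.IsFirst j ∧ x.part j i := by
  classical
  have h : ∃ j, x.part j i := ⟨i, x.part.refl' i⟩
  refine ⟨Nat.find h, fun j hj hx => ?_, Nat.find_spec h⟩
  exact Nat.find_min h hj (x.part.trans' hx (Nat.find_spec h))

theorem disjoint_block {x : MarkedPartition} {i j : ℕ} (hi : x.IsFirst i) (hj : x.IsFirst j)
    (h : i ≠ j) : Disjoint (x.block i) (x.block j) :=
  Set.disjoint_left.2 fun _ hk hk' => h (hi.eq hj (x.part.trans' (x.part.symm' hk) hk'))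

theorem block_mem_classes (x : MarkedPartition) (i : ℕ) : x.block i ∈ x.part.classes := ⟨i, rfl⟩

theorem hasFreq_block_iff {x : MarkedPartition} {i : ℕ} {a : ℝ} :
    HasFreq (x.block i) a ↔ Tendsto (x.ratio i) atTop (𝓝 a) := Iff.rfl

theorem freq_eq {x : MarkedPartition} {i : ℕ} {a : ℝ} (h : HasFreq (x.block i) a) :
    x.freq i = a := Tendsto.limUnder_eq h

theorem hasAsymptoticFreqs_iff {x : MarkedPartition} :
    x.HasAsymptoticFreqs ↔ ∀ i, ∃ a, Tendsto (x.ratio i) atTop (𝓝 a) := by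
  constructor
  · exact fun h i => h _ (x.block_mem_classes i)
  · rintro h _ ⟨i, rfl⟩
    exact h i

theorem HasAsymptoticFreqs.tendsto {x : MarkedPartition} (hx : x.HasAsymptoticFreqs) (i : ℕ) :
    Tendsto (x.ratio i) atTop (𝓝 (x.freq i)) :=
  tendsto_nhds_limUnder (hasAsymptoticFreqs_iff.1 hx i)

theorem ratio_nonneg (x : MarkedPartition) (i n : ℕ) : 0 ≤ x.ratio i n := by
  unfold ratio; positivity

theorem freq_nonneg {x : MarkedPartition} (hx : x.HasAsymptoticFreqs) (i : ℕ) : 0 ≤ x.freq i :=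
  ge_of_tendsto' (hx.tendsto i) fun n => x.ratio_nonneg i n

theorem freq_congr {x : MarkedPartition} {i j : ℕ} (h : x.part i j) : x.freq i = x.freq j := by
  unfold freq ratio; rw [block_eq h]

theorem mark_congr {x : MarkedPartition} {i j : ℕ} (h : x.part i j) : x.mark i = x.mark j :=
  x.2 i j h

/-- An integer belongs to at most one of the blocks with distinct first elements. -/
theorem sum_ratio_le_one {x : MarkedPartition} {S : Finset ℕ} (hS : ∀ i ∈ S, x.IsFirst i)
    (n : ℕ) : ∑ i ∈ S, x.ratio i n ≤ 1 := by
  unfold ratio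
  rw [← Finset.sum_div]
  refine div_le_one_of_le₀ ?_ (by positivity)
  classical
  simp_rw [ncard_inter_Iio]
  rw [Finset.sum_comm]
  calc _ ≤ ∑ j ∈ Finset.range n, (1 : ℝ) := by
        refine Finset.sum_le_sum fun j _ => ?_
        rw [Finset.sum_boole]
        norm_cast
        refine Finset.card_le_one.2 fun a ha b hb => ?_
        simp only [Finset.mem_filter] at ha hb
        exact (hS a ha.1).eq (hS b hb.1) (x.part.trans' (x.part.symm' ha.2) hb.2)
    _ = n := by simp

theorem ratio_le_one (x : MarkedPartition) (i n : ℕ) : x.ratio i n ≤ 1 := by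
  obtain ⟨j, hj, h⟩ := x.exists_isFirst i
  have := sum_ratio_le_one (x := x) (S := {j}) (by simpa using hj) n
  rw [Finset.sum_singleton] at this
  unfold ratio at this ⊢
  rwa [← block_eq h]

theorem freq_le_one {x : MarkedPartition} (hx : x.HasAsymptoticFreqs) (i : ℕ) : x.freq i ≤ 1 :=
  le_of_tendsto' (hx.tendsto i) fun n => x.ratio_le_one i n

theorem sum_freq_le_one {x : MarkedPartition} (hx : x.HasAsymptoticFreqs) {S : Finset ℕ}
    (hS : ∀ i ∈ S, x.IsFirst i) : ∑ i ∈ S, x.freq i ≤ 1 :=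
  le_of_tendsto' (tendsto_finsetSum _ fun i _ => hx.tendsto i) fun n => sum_ratio_le_one hS n

open Classical in
/-- The frequency of the block whose first element is `i`. -/
noncomputable def firstFreq (x : MarkedPartition) (i : ℕ) : ℝ := if x.IsFirst i then x.freq i else 0

theorem firstFreq_nonneg {x : MarkedPartition} (hx : x.HasAsymptoticFreqs) (i : ℕ) :
    0 ≤ x.firstFreq i := by
  unfold firstFreq; split_ifs
  exacts [freq_nonneg hx i, le_rfl]

theorem sum_firstFreq_le_one {x : MarkedPartition} (hx : x.HasAsymptoticFreqs) (S : Finset ℕ) :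
    ∑ i ∈ S, x.firstFreq i ≤ 1 := by
  classical
  unfold firstFreq
  rw [← Finset.sum_filter]
  exact sum_freq_le_one hx (by simp)

theorem summable_firstFreq {x : MarkedPartition} (hx : x.HasAsymptoticFreqs) :
    Summable x.firstFreq :=
  summable_of_sum_le (firstFreq_nonneg hx) (sum_firstFreq_le_one hx)

/-- The blocks with a positive frequency correspond to their first elements. -/
noncomputable def firstEquiv (x : MarkedPartition) (hx : x.HasAsymptoticFreqs) :
    {i : ℕ // x.IsFirst i ∧ 0 < x.freq i} ≃
      {B : Set ℕ // B ∈ x.part.classes ∧ ∃ a : ℝ, 0 < a ∧ HasFreq B a} :=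
  Equiv.ofBijective
    (fun i => ⟨x.block i, x.block_mem_classes i, x.freq i, i.2.2, hx.tendsto i⟩) (by
      constructor
      · intro i j h
        exact Subtype.ext (i.2.1.eq j.2.1 (block_eq_iff.1 (congrArg Subtype.val h)))
      · rintro ⟨_, ⟨i, rfl⟩, a, ha, h⟩
        obtain ⟨j, hj, hji⟩ := x.exists_isFirst i
        refine ⟨⟨j, hj, ?_⟩, Subtype.ext (block_eq hji)⟩
        rw [freq_congr hji, freq_eq h]
        exact ha)

/-- Replacing a block by its first element makes the index set a subset of `ℕ`, over which sums and
measurable unions can be taken. -/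
theorem isRanking_iff {x : MarkedPartition} (hx : x.HasAsymptoticFreqs) {z : RankedSeq} :
    x.IsRanking z ↔ ∃ g : {k : ℕ // 0 < z.s k} ≃ {i : ℕ // x.IsFirst i ∧ 0 < x.freq i},
      ∀ k, x.freq (g k) = z.s k ∧ x.mark (g k) = z.v k := by
  constructor
  · rintro ⟨e, he⟩
    refine ⟨e.trans (x.firstEquiv hx).symm, fun k => ?_⟩
    have hb : x.block ((x.firstEquiv hx).symm (e k)) = (e k).1 :=
      congrArg Subtype.val ((x.firstEquiv hx).apply_symm_apply (e k))
    exact ⟨freq_eq (hb ▸ (he k).1), (he k).2 _ (hb ▸ mem_block_self x _)⟩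
  · rintro ⟨g, hg⟩
    refine ⟨g.trans (x.firstEquiv hx), fun k => ⟨?_, fun i hi => ?_⟩⟩
    · rw [← (hg k).1]
      exact hx.tendsto _
    · rw [← (hg k).2]
      exact mark_congr hi

/-- The pair of the frequency and of the mark of the block of `i`. -/
noncomputable def freqMark (x : MarkedPartition) (i : ℕ) : ℝ ×ₗ ℝ≥0 :=
  toLex (x.freq i, (x.mark i).val)

theorem fst_le_of_toLex_le {a b : ℝ × ℝ≥0} (h : toLex a ≤ toLex b) : a.1 ≤ b.1 := by
  rcases (Prod.Lex.toLex_le_toLex).1 h with h | h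
  exacts [h.le, h.1.le]

theorem finite_freq_ge {x : MarkedPartition} (hx : x.HasAsymptoticFreqs) {a : ℝ} (ha : 0 < a) :
    {i | x.IsFirst i ∧ a ≤ x.freq i}.Finite := by
  have h := (summable_firstFreq hx).tendsto_cofinite_zero.eventually (gt_mem_nhds ha)
  rw [Filter.eventually_cofinite] at h
  refine h.subset fun i hi => ?_
  simp only [firstFreq, Set.mem_ofPred_eq, if_pos hi.1, not_lt]
  exact hi.2

theorem exists_isRanking {x : MarkedPartition} (hx : x.HasAsymptoticFreqs) :
    ∃ z, x.IsRanking z := by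
  classical
  set I := {i : ℕ // x.IsFirst i ∧ 0 < x.freq i}
  -- The first element breaks ties between blocks with the same frequency and mark, which makes the
  -- key injective.
  let q : I → (ℝ ×ₗ ℝ≥0) ×ₗ ℕ := fun i => toLex (x.freqMark i, i.1)
  have hq : Function.Injective q := fun i j h => Subtype.ext (congrArg (fun p => (ofLex p).2) h)
  have hqle : ∀ {i j}, q i ≤ q j → x.freqMark i ≤ x.freqMark j := by
    intro i j h
    rcases Prod.Lex.toLex_le_toLex.1 h with h | h
    exacts [h.le, h.1.le]
  -- A block above `i` has at least the frequency of `i`, which is positive, so there are finitely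
  -- many.
  obtain ⟨r, hr, hlow⟩ := exists_rank q hq fun i => by
    refine Set.Finite.of_finite_image (f := Subtype.val) ?_ Subtype.val_injective.injOn
    refine (finite_freq_ge hx i.2.2).subset ?_
    rintro _ ⟨j, hj, rfl⟩
    exact ⟨j.2.1, fst_le_of_toLex_le (hqle (le_of_lt hj))⟩
  have hinj : Function.Injective r := by
    intro i j h
    rcases lt_trichotomy (q i) (q j) with h' | h' | h'
    · have := hr _ _ h'; omega
    · exact hq h'
    · have := hr _ _ h'; omega
  let z : ℕ → ℝ × ℝ≥0 := fun k =>
    if h : ∃ i, r i = k then (x.freq h.choose, (x.mark h.choose).val) else (0, 0)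
  have hz : ∀ i, z (r i) = (x.freq i, (x.mark i).val) := by
    intro i
    have h : ∃ j, r j = r i := ⟨i, rfl⟩
    have h' := hinj h.choose_spec
    simp only [z, dif_pos h]
    rw [h']
  have hz0 : ∀ k, (¬ ∃ i, r i = k) → z k = (0, 0) := fun k h => dif_neg h
  have hnonneg : ∀ k, 0 ≤ (z k).1 := by
    intro k
    by_cases h : ∃ i, r i = k
    · obtain ⟨i, rfl⟩ := h
      rw [hz]
      exact i.2.2.le
    · simp [hz0 k h]
  have hsum : ∀ S : Finset ℕ, ∑ k ∈ S, (z k).1 ≤ 1 := by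
    intro S
    have : ∑ k ∈ S, (z k).1 = ∑ k ∈ S.filter fun k => ∃ i, r i = k, (z k).1 := by
      rw [Finset.sum_filter]
      refine Finset.sum_congr rfl fun k _ => ?_
      split_ifs with h
      · rfl
      · simp [hz0 k h]
    rw [this]
    let S' : Finset I := S.preimage r hinj.injOn
    have h2 : S.filter (fun k => ∃ i, r i = k) = S'.image r := by
      ext k
      simp only [Finset.mem_filter, Finset.mem_image, S', Finset.mem_preimage]
      constructor
      · rintro ⟨hk, i, rfl⟩
        exact ⟨i, hk, rfl⟩
      · rintro ⟨i, hi, rfl⟩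
        exact ⟨hi, i, rfl⟩
    rw [h2, Finset.sum_image hinj.injOn]
    simp_rw [hz]
    rw [← Finset.sum_image (f := x.freq) (g := Subtype.val) Subtype.val_injective.injOn]
    refine sum_freq_le_one hx fun i hi => ?_
    obtain ⟨j, -, rfl⟩ := Finset.mem_image.1 hi
    exact j.2.1
  have hsummable : Summable fun k => (z k).1 := summable_of_sum_le hnonneg hsum
  have hpos : ∀ k, 0 < (z k).1 ↔ ∃ i, r i = k := by
    intro k
    constructor
    · intro h
      by_contra h'
      simp [hz0 k h'] at h
    · rintro ⟨i, rfl⟩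
      rw [hz]
      exact i.2.2
  have hanti : Antitone fun k => toLex (z k) := by
    intro k l hkl
    by_cases h : ∃ i, r i = l
    · obtain ⟨i, rfl⟩ := h
      obtain ⟨j, rfl⟩ := hlow i k hkl
      simp only [hz]
      refine hqle (not_lt.1 fun h => ?_)
      have := hr _ _ h
      omega
    · simp only [hz0 l h]
      rw [Prod.Lex.toLex_le_toLex]
      rcases (hnonneg k).lt_or_eq with h | h
      exacts [Or.inl h, Or.inr ⟨h, zero_le⟩]
  let e : I ≃ {k : ℕ // 0 < (z k).1} :=
    Equiv.ofBijective (fun i => ⟨r i, (hpos _).2 ⟨i, rfl⟩⟩) ⟨fun i j h =>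
      hinj (congrArg Subtype.val h), fun ⟨k, hk⟩ => by
        obtain ⟨i, rfl⟩ := (hpos k).1 hk
        exact ⟨i, rfl⟩⟩
  have he : ∀ k, x.freq (e.symm k) = (z k).1 ∧ x.mark (e.symm k) = ⟨(z k).2⟩ := by
    intro k
    obtain ⟨i, rfl⟩ := e.surjective k
    rw [Equiv.symm_apply_apply]
    exact ⟨(congrArg Prod.fst (hz i)).symm, congrArg Mark.mk (congrArg Prod.snd (hz i)).symm⟩
  refine ⟨⟨z, fun k => ⟨hnonneg k, ?_⟩, hanti, hsummable, hsummable.tsum_le_of_sum_le hsum, ?_⟩,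
    (isRanking_iff hx).2 ⟨e.symm, he⟩⟩
  · simpa using hsum {k}
  · intro k hk
    have : ¬ ∃ i, r i = k := fun h => (hk ▸ (hpos k).2 h).false
    simp [hz0 k this]

/-- Counting the blocks above a threshold determines the ranking. The right-hand side does not
mention `z`, which gives uniqueness, and it is a union over countably many finite sets, which gives
measurability. The threshold has a positive first coordinate so that only ranked blocks are counted.
-/
theorem IsRanking.le_iff {x : MarkedPartition} (hx : x.HasAsymptoticFreqs) {z : RankedSeq}
    (hz : x.IsRanking z) {c : ℝ × ℝ≥0} (hc : 0 < c.1) (k : ℕ) :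
    toLex c ≤ toLex (z.1 k) ↔
      ∃ S : Finset ℕ, S.card = k + 1 ∧ ∀ i ∈ S, x.IsFirst i ∧ toLex c ≤ x.freqMark i := by
  classical
  obtain ⟨g, hg⟩ := (isRanking_iff hx).1 hz
  have hgz : ∀ l, x.freqMark (g l) = toLex (z.1 l) := by
    intro l
    unfold freqMark
    rw [(hg l).1, (hg l).2]
    rfl
  constructor
  · intro h
    have hle : ∀ l : Fin (k + 1), toLex c ≤ toLex (z.1 l) := fun l =>
      h.trans (z.2.2.1 (Nat.lt_succ_iff.1 l.2))
    let l' : Fin (k + 1) → {k : ℕ // 0 < z.s k} :=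
      fun l => ⟨l, hc.trans_le (fst_le_of_toLex_le (hle l))⟩
    refine ⟨Finset.univ.image fun l => (g (l' l)).1, ?_, ?_⟩
    · rw [Finset.card_image_of_injective, Finset.card_univ, Fintype.card_fin]
      intro a b hab
      have := g.injective (Subtype.ext hab)
      exact Fin.ext (congrArg Subtype.val this)
    · intro i hi
      obtain ⟨l, -, rfl⟩ := Finset.mem_image.1 hi
      exact ⟨(g (l' l)).2.1, (hgz _).symm ▸ hle l⟩
  · rintro ⟨S, hS, h⟩
    by_contra hlt
    rw [not_le] at hlt
    have hi : ∀ i ∈ S, ∃ l : {k : ℕ // 0 < z.s k}, l.1 < k ∧ (g l).1 = i := by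
      intro i hi
      obtain ⟨l, hl⟩ := g.surjective ⟨i, (h i hi).1,
        hc.trans_le (fst_le_of_toLex_le (h i hi).2)⟩
      have hl' : (g l).1 = i := congrArg Subtype.val hl
      refine ⟨l, ?_, hl'⟩
      by_contra hkl
      have h1 := z.2.2.1 (not_lt.1 hkl)
      have h2 := (h i hi).2
      rw [← hl', hgz] at h2
      exact (h2.trans h1).not_gt hlt
    have : Nonempty {k : ℕ // 0 < z.s k} := by
      obtain ⟨i, hiS⟩ := Finset.card_pos.1 (k.succ_pos.trans_eq hS.symm)
      exact ⟨(hi i hiS).choose⟩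
    choose! l hl using hi
    have hcard : S.card ≤ (Finset.range k).card :=
      Finset.card_le_card_of_injOn (fun i => (l i).1)
        (fun i hi => Finset.mem_coe.2 (Finset.mem_range.2 (hl i hi).1)) fun i hi j hj hij => by
          rw [← (hl i hi).2, ← (hl j hj).2, Subtype.ext hij]
    rw [hS, Finset.card_range] at hcard
    omega

theorem IsRanking.unique {x : MarkedPartition} (hx : x.HasAsymptoticFreqs) {z z' : RankedSeq}
    (hz : x.IsRanking z) (hz' : x.IsRanking z') : z = z' := by
  have key : ∀ {z z' : RankedSeq}, x.IsRanking z → x.IsRanking z' → ∀ k,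
      toLex (z.1 k) ≤ toLex (z'.1 k) := by
    intro z z' hz hz' k
    rcases (z.2.1 k).1.lt_or_eq with h | h
    · exact (hz'.le_iff hx h k).2 ((hz.le_iff hx h k).1 le_rfl)
    · rw [Prod.Lex.toLex_le_toLex]
      rcases (z'.2.1 k).1.lt_or_eq with h' | h'
      · exact Or.inl (h ▸ h')
      · exact Or.inr ⟨h.symm.trans h', by rw [z.2.2.2.2.2 k h.symm]; exact zero_le⟩
  exact Subtype.ext (funext fun k => toLex.injective (le_antisymm (key hz hz' k) (key hz' hz k)))

theorem isRanking_ranked {x : MarkedPartition} (hx : x.HasAsymptoticFreqs) :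
    x.IsRanking x.ranked := by
  have h : x.HasAsymptoticFreqs ∧ ∃ z, x.IsRanking z := ⟨hx, exists_isRanking hx⟩
  rw [ranked, dif_pos h]
  exact h.2.choose_spec

theorem ranked_eq {x : MarkedPartition} (hx : x.HasAsymptoticFreqs) {z : RankedSeq}
    (hz : x.IsRanking z) : x.ranked = z :=
  (isRanking_ranked hx).unique hx hz

theorem ranked_of_not {x : MarkedPartition} (hx : ¬ x.HasAsymptoticFreqs) :
    x.ranked = RankedSeq.zero := by
  rw [ranked, dif_neg fun h => hx h.1]

theorem measurable_ratio (i n : ℕ) : Measurable fun x : MarkedPartition => x.ratio i n := by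
  classical
  unfold ratio
  simp_rw [ncard_inter_Iio]
  refine (Finset.measurable_sum _ fun j _ => ?_).div_const _
  exact Measurable.ite (measurableSet_part j i) measurable_const measurable_const

theorem measurable_freq (i : ℕ) : Measurable fun x : MarkedPartition => x.freq i :=
  (StronglyMeasurable.limUnder fun n => (measurable_ratio i n).stronglyMeasurable).measurable

theorem measurableSet_isFirst (i : ℕ) : MeasurableSet {x : MarkedPartition | x.IsFirst i} := by
  simp only [IsFirst, Set.ofPred_forall]
  exact .iInter fun j => .iInter fun _ => (measurableSet_part j i).compl

theorem measurableSet_hasAsymptoticFreqs :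
    MeasurableSet {x : MarkedPartition | x.HasAsymptoticFreqs} := by
  simp only [hasAsymptoticFreqs_iff, Set.ofPred_forall]
  exact .iInter fun i => measurableSet_exists_tendsto fun n => measurable_ratio i n

theorem measurableSet_le_freqMark {a : MarkedPartition → ℝ} (ha : Measurable a) (b : ℝ≥0) (i : ℕ) :
    MeasurableSet {x : MarkedPartition | toLex (a x, b) ≤ x.freqMark i} := by
  simp only [freqMark, Prod.Lex.toLex_le_toLex]
  have h : MeasurableSet {x : MarkedPartition | b ≤ (x.mark i).val} :=
    measurableSet_le measurable_const (Mark.measurable_val.comp (measurable_mark i))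
  exact (measurableSet_lt ha (measurable_freq i)).union
    ((measurableSet_eq_fun ha (measurable_freq i)).inter h)

theorem measurableSet_exists_finset {a : MarkedPartition → ℝ} (ha : Measurable a) (b : ℝ≥0)
    (k : ℕ) : MeasurableSet {x : MarkedPartition | ∃ S : Finset ℕ, S.card = k + 1 ∧
      ∀ i ∈ S, x.IsFirst i ∧ toLex (a x, b) ≤ x.freqMark i} := by
  simp only [Set.ofPred_exists, Set.ofPred_and, Set.ofPred_forall]
  exact .iUnion fun S => (MeasurableSet.const _).inter (.iInter fun i => .iInter fun _ =>
    (measurableSet_isFirst i).inter (measurableSet_le_freqMark ha b i))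

theorem measurable_ranked_s (k : ℕ) : Measurable fun x : MarkedPartition => x.ranked.s k := by
  refine measurable_of_Ici fun a => ?_
  rcases le_or_gt a 0 with ha | ha
  · convert! MeasurableSet.univ
    ext x
    simp only [Set.mem_preimage, Set.mem_Ici, Set.mem_univ, iff_true]
    exact ha.trans (x.ranked.2.1 k).1
  · convert! measurableSet_hasAsymptoticFreqs.inter (measurableSet_exists_finset
      (measurable_const (a := a)) 0 k) using 1
    ext x
    simp only [Set.mem_preimage, Set.mem_Ici, Set.mem_inter_iff, Set.mem_ofPred_eq]
    by_cases hx : x.HasAsymptoticFreqs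
    · rw [← (isRanking_ranked hx).le_iff hx (c := (a, 0)) ha k, Prod.Lex.toLex_le_toLex]
      simp only [hx, true_and, zero_le, and_true]
      exact le_iff_lt_or_eq
    · rw [ranked_of_not hx]
      simp only [hx, false_and, iff_false, not_le]
      exact ha

/-- The threshold is taken to be `(s_k, b)` with the random frequency `s_k` itself: the
lexicographic comparison then reduces to that of the marks. This is why the preceding measurability
lemmas allow a first coordinate that depends on `x`. -/
theorem measurable_ranked_v (k : ℕ) :
    Measurable fun x : MarkedPartition => (x.ranked.1 k).2 := by
  refine measurable_of_Ici fun b => ?_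
  rcases eq_or_lt_of_le (zero_le (a := b)) with rfl | hb
  · convert! MeasurableSet.univ
    ext x
    simp
  · convert! (measurableSet_hasAsymptoticFreqs.inter
      (measurableSet_lt measurable_const (measurable_ranked_s k) :
        MeasurableSet {x : MarkedPartition | 0 < x.ranked.s k})).inter
      (measurableSet_exists_finset (measurable_ranked_s k) b k) using 1
    ext x
    simp only [Set.mem_preimage, Set.mem_Ici, Set.mem_inter_iff, Set.mem_ofPred_eq]
    by_cases hx : x.HasAsymptoticFreqs
    · rcases (x.ranked.2.1 k).1.lt_or_eq with hs | hs
      · have hs' : 0 < x.ranked.s k := hs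
        rw [← (isRanking_ranked hx).le_iff hx (c := (x.ranked.s k, b)) hs k,
          Prod.Lex.toLex_le_toLex]
        change b ≤ _ ↔ _ ∧ (_ < x.ranked.s k ∨ _ = x.ranked.s k ∧ b ≤ _)
        simp only [hx, hs', true_and, lt_irrefl, false_or]
      · have h1 : ¬ 0 < x.ranked.s k := by
          rw [not_lt]; exact hs.ge
        rw [x.ranked.2.2.2.2.2 k hs.symm]
        simp only [h1, and_false, false_and, iff_false, not_le]
        exact hb
    · rw [ranked_of_not hx]
      simp only [hx, false_and, iff_false, not_le]
      exact hb

theorem measurable_ranked : Measurable ranked :=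
  Measurable.subtype_mk (f := fun x : MarkedPartition => x.ranked.1) <| measurable_pi_iff.2 fun k =>
    (measurable_ranked_s k).prodMk (measurable_ranked_v k)

end MarkedPartition

/-! ### The strong law for paintboxes and the uniqueness of the mixing measure. -/

theorem hasFreq_iff {B : Set ℕ} {a : ℝ} [DecidablePred (· ∈ B)] : HasFreq B a ↔
    Tendsto (fun n : ℕ => (∑ j ∈ Finset.range n, if j ∈ B then (1 : ℝ) else 0) / n) atTop
      (𝓝 a) := by
  unfold HasFreq
  simp_rw [ncard_inter_Iio]
  convert! Iff.rfl

theorem HasFreq.unique {B : Set ℕ} {a b : ℝ} (ha : HasFreq B a) (hb : HasFreq B b) : a = b :=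
  tendsto_nhds_unique ha hb

theorem Set.Finite.hasFreq {B : Set ℕ} (hB : B.Finite) : HasFreq B 0 := by
  refine squeeze_zero (fun n => by positivity) (fun n => ?_)
    (tendsto_const_div_atTop_nhds_zero_nat (B.ncard : ℝ))
  gcongr
  · exact Set.inter_subset_left

open ProbabilityTheory in
/-- The strong law of large numbers for the number of visits to a set. -/
theorem ae_hasFreq_infinitePi {A : Type*} [MeasurableSpace A] (α : Measure A)
    [IsProbabilityMeasure α] {B : Set A} (hB : MeasurableSet B) :
    ∀ᵐ u ∂(Measure.infinitePi fun _ : ℕ => α), HasFreq {j | u j ∈ B} (α.real B) := by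
  classical
  set P := Measure.infinitePi fun _ : ℕ => α
  let φ : A → ℝ := B.indicator 1
  have hφ : Measurable φ := measurable_one.indicator hB
  have hind : iIndepFun (fun (i : ℕ) (u : ℕ → A) => φ (u i)) P :=
    iIndepFun_infinitePi (X := fun _ => φ) fun _ => hφ
  have hid : ∀ i, IdentDistrib (fun u : ℕ → A => φ (u i)) (fun u => φ (u 0)) P P := by
    intro i
    have : IdentDistrib (fun u : ℕ → A => u i) (fun u => u 0) P P :=
      ⟨(measurable_pi_apply i).aemeasurable, (measurable_pi_apply 0).aemeasurable, by
        rw [Measure.infinitePi_map_eval, Measure.infinitePi_map_eval]⟩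
    exact this.comp hφ
  have hint : Integrable (fun u : ℕ → A => φ (u 0)) P := by
    refine Integrable.of_bound (hφ.comp (measurable_pi_apply 0)).aestronglyMeasurable 1
      (.of_forall fun u => ?_)
    simp only [φ, Set.indicator_apply]
    split_ifs <;> simp
  have key := strong_law_ae_real (fun (i : ℕ) (u : ℕ → A) => φ (u i)) hint
    (fun i j hij => hind.indepFun hij) hid
  have hE : ∫ u, φ (u 0) ∂P = α.real B := by
    have : ∫ u, φ (u 0) ∂P = ∫ a, φ a ∂(P.map fun u => u 0) :=
      (integral_map (measurable_pi_apply 0).aemeasurable hφ.aestronglyMeasurable).symm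
    rw [this, Measure.infinitePi_map_eval, integral_indicator_one hB]
  filter_upwards [key] with u hu
  rw [hE] at hu
  rw [hasFreq_iff]
  convert! hu using 2

namespace RankedSeq

theorem s_nonneg (z : RankedSeq) (k : ℕ) : 0 ≤ z.s k := (z.2.1 k).1

theorem t_nonneg (z : RankedSeq) (n : ℕ) : 0 ≤ z.t n :=
  Finset.sum_nonneg fun k _ => z.s_nonneg k

theorem t_le_one (z : RankedSeq) (n : ℕ) : z.t n ≤ 1 :=
  (z.2.2.2.1.sum_le_tsum _ fun k _ => z.s_nonneg k).trans z.2.2.2.2.1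

/-- The points of `[0, 1]` that are in the `n`-th interval. -/
def boxSet (z : RankedSeq) (n : ℕ) : Set unitInterval := {u | (u : ℝ) ∈ z.box n}

theorem measurableSet_boxSet (z : RankedSeq) (n : ℕ) : MeasurableSet (z.boxSet n) :=
  measurable_subtype_coe measurableSet_Ico

theorem volume_boxSet (z : RankedSeq) (n : ℕ) :
    (volume : Measure unitInterval) (z.boxSet n) = ENNReal.ofReal (z.s n) := by
  have h : z.boxSet n = Set.Ico (⟨z.t n, z.t_nonneg n, z.t_le_one n⟩ : unitInterval)
      ⟨z.t (n + 1), z.t_nonneg _, z.t_le_one _⟩ := rfl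
  rw [h, unitInterval.volume_Ico]
  simp [t, Finset.sum_range_succ]

theorem real_boxSet (z : RankedSeq) (n : ℕ) :
    (volume : Measure unitInterval).real (z.boxSet n) = z.s n := by
  rw [Measure.real, volume_boxSet, ENNReal.toReal_ofReal (z.s_nonneg n)]

/-- The points `u_0, u_1, …` visit the intervals with the right frequencies. -/
def Typical (z : RankedSeq) (u : ℕ → unitInterval) : Prop :=
  ∀ n, HasFreq {j | u j ∈ z.boxSet n} (z.s n)

theorem ae_typical (z : RankedSeq) :
    ∀ᵐ u ∂(Measure.infinitePi fun _ : ℕ => (volume : Measure unitInterval)), z.Typical u := by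
  refine ae_all_iff.2 fun n => ?_
  have := ae_hasFreq_infinitePi (volume : Measure unitInterval) (z.measurableSet_boxSet n)
  rwa [real_boxSet] at this

theorem paint_block {z : RankedSeq} {u : ℕ → unitInterval} {i n : ℕ} (h : u i ∈ z.boxSet n) :
    (z.paint u).block i = {j | u j ∈ z.boxSet n} := by
  ext j
  constructor
  · rintro (rfl | ⟨m, hj, hi⟩)
    · exact h
    · exact z.box_unique hi h ▸ hj
  · exact fun hj => Or.inr ⟨n, hj, h⟩

theorem paint_block_of_notMem {z : RankedSeq} {u : ℕ → unitInterval} {i : ℕ}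
    (h : ∀ n, u i ∉ z.boxSet n) : (z.paint u).block i = {i} := by
  ext j
  constructor
  · rintro (rfl | ⟨m, -, hi⟩)
    · rfl
    · exact absurd hi (h m)
  · rintro rfl
    exact MarkedPartition.mem_block_self _ _

theorem s_pos_of_mem {z : RankedSeq} {u : unitInterval} {n : ℕ} (h : u ∈ z.boxSet n) :
    0 < z.s n := by
  have h' : z.t n < z.t (n + 1) := h.1.trans_lt h.2
  simpa [t, Finset.sum_range_succ] using h'

theorem Typical.infinite {z : RankedSeq} {u : ℕ → unitInterval} (hu : z.Typical u) {n : ℕ}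
    (hn : 0 < z.s n) : {j | u j ∈ z.boxSet n}.Infinite :=
  fun h => hn.ne' ((hu n).unique h.hasFreq)

theorem Typical.hasAsymptoticFreqs {z : RankedSeq} {u : ℕ → unitInterval} (hu : z.Typical u) :
    (z.paint u).HasAsymptoticFreqs := by
  rintro _ ⟨i, rfl⟩
  change ∃ a, HasFreq ((z.paint u).block i) a
  by_cases h : ∃ n, u i ∈ z.boxSet n
  · obtain ⟨n, hn⟩ := h
    exact ⟨_, (paint_block hn).symm ▸ hu n⟩
  · push Not at h
    exact ⟨_, (paint_block_of_notMem h).symm ▸ (Set.finite_singleton i).hasFreq⟩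

theorem Typical.nonDegenerate {z : RankedSeq} {u : ℕ → unitInterval} (hu : z.Typical u) :
    (z.paint u).NonDegenerate := by
  intro i hi
  by_cases h : ∃ n, u i ∈ z.boxSet n
  · obtain ⟨n, hn⟩ := h
    refine absurd hi ?_
    have : {j | (z.paint u).part i j} = (z.paint u).block i := by
      ext j
      exact ⟨fun h => (z.paint u).part.symm' h, fun h => (z.paint u).part.symm' h⟩
    rw [this, paint_block hn]
    exact hu.infinite (s_pos_of_mem hn)
  · exact dif_neg h

/-- Intervals of positive length are visited with the right frequency, hence each of them paints a
block; all other blocks are singletons, of frequency zero. -/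
theorem Typical.isRanking {z : RankedSeq} {u : ℕ → unitInterval} (hu : z.Typical u) :
    (z.paint u).IsRanking z := by
  have hex : ∀ k : {k : ℕ // 0 < z.s k}, ∃ i, u i ∈ z.boxSet k := fun k =>
    (hu.infinite k.2).nonempty
  let f : {k : ℕ // 0 < z.s k} →
      {B : Set ℕ // B ∈ (z.paint u).part.classes ∧ ∃ a : ℝ, 0 < a ∧ HasFreq B a} :=
    fun k => ⟨{j | u j ∈ z.boxSet k}, by
      obtain ⟨i, hi⟩ := hex k
      exact paint_block hi ▸ MarkedPartition.block_mem_classes _ i, z.s k, k.2, hu k⟩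
  have hf : Function.Bijective f := by
    constructor
    · intro k l h
      obtain ⟨i, hi⟩ := hex k
      have hi' : i ∈ (f l).1 := h ▸ hi
      exact Subtype.ext (z.box_unique hi hi')
    · rintro ⟨_, ⟨i, rfl⟩, a, ha, h⟩
      change HasFreq ((z.paint u).block i) a at h
      by_cases hn : ∃ n, u i ∈ z.boxSet n
      · obtain ⟨n, hn⟩ := hn
        exact ⟨⟨n, s_pos_of_mem hn⟩, Subtype.ext (paint_block hn).symm⟩
      · push Not at hn
        rw [paint_block_of_notMem hn] at h
        exact absurd (h.unique (Set.finite_singleton i).hasFreq) ha.ne'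
  exact ⟨Equiv.ofBijective f hf, fun k => ⟨hu k, fun i hi => z.paintMark_of_mem hi⟩⟩

theorem Typical.ranked_paint {z : RankedSeq} {u : ℕ → unitInterval} (hu : z.Typical u) :
    (z.paint u).ranked = z :=
  MarkedPartition.ranked_eq hu.hasAsymptoticFreqs hu.isRanking

/-- Restricting to non-degenerate marked partitions loses no mass, since typical points paint a
non-degenerate one. -/
theorem paintboxLaw_preimage_val (z : RankedSeq) {A : Set MarkedPartition}
    (hA : MeasurableSet A) :
    z.paintboxLaw (Subtype.val ⁻¹' A) =
      (Measure.infinitePi fun _ : ℕ => (volume : Measure unitInterval)) (z.paint ⁻¹' A) := by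
  rw [paintboxLaw_apply z (measurable_subtype_coe hA)]
  refine measure_congr ?_
  filter_upwards [z.ae_typical] with u hu
  refine propext ⟨?_, fun h => ⟨⟨_, hu.nonDegenerate⟩, h, rfl⟩⟩
  rintro ⟨x, hx, h⟩
  exact (h ▸ hx : z.paint u ∈ A)

instance (z : RankedSeq) : IsProbabilityMeasure z.paintboxLaw :=
  ⟨by simpa using z.paintboxLaw_preimage_val .univ⟩

/-- The directing sequence is a function of the realization; uniqueness of the mixing measure rests
on this. -/
theorem ae_paintboxLaw (z : RankedSeq) :
    ∀ᵐ x ∂z.paintboxLaw, x.1.HasAsymptoticFreqs ∧ x.1.ranked = z := by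
  have hm : MeasurableSet {x : MarkedPartition | x.HasAsymptoticFreqs ∧ x.ranked = z} :=
    MarkedPartition.measurableSet_hasAsymptoticFreqs.inter
      (MarkedPartition.measurable_ranked (measurableSet_singleton z))
  rw [ae_iff]
  refine (z.paintboxLaw_preimage_val hm.compl).trans ?_
  have := ae_iff.1 z.ae_typical
  refine measure_mono_null ?_ this
  intro u hu h
  refine hu ?_
  exact ⟨h.hasAsymptoticFreqs, h.ranked_paint⟩

end RankedSeq

/-- A mixing measure is determined by the mixture of paintbox laws. -/
theorem map_ranked_bind_paintboxLaw (ν : Measure RankedSeq) :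
    (ν.bind RankedSeq.paintboxLaw).map (fun x : NonDegPartition => x.1.ranked) = ν := by
  have hr : Measurable fun x : NonDegPartition => x.1.ranked :=
    MarkedPartition.measurable_ranked.comp measurable_subtype_coe
  ext A hA
  rw [Measure.map_apply hr hA,
    Measure.bind_apply (hr hA) RankedSeq.measurable_paintboxLaw.aemeasurable,
    ← lintegral_indicator_one hA]
  -- Under `ρ_z` the ranked sequence is almost surely `z`, so the event has mass `1` or `0`
  -- according to whether `z ∈ A`.
  refine lintegral_congr fun z => ?_
  by_cases hz : z ∈ A
  · rw [Set.indicator_of_mem hz, Pi.one_apply, ← measure_univ (μ := z.paintboxLaw)]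
    refine measure_congr ?_
    filter_upwards [z.ae_paintboxLaw] with x hx
    exact propext ⟨fun _ => trivial, fun _ => (hx.2.symm ▸ hz : x.1.ranked ∈ A)⟩
  · rw [Set.indicator_of_notMem hz, ← measure_empty (μ := z.paintboxLaw)]
    refine measure_congr ?_
    filter_upwards [z.ae_paintboxLaw] with x hx
    exact propext ⟨fun h => hz (hx.2 ▸ h), fun h => h.elim⟩

/-! ### A law of large numbers from exchangeable second moments. -/

theorem ae_summable_of_summable_integral {Ω : Type*} [MeasurableSpace Ω] {P : Measure Ω}
    {f : ℕ → Ω → ℝ} (hf : ∀ k, Integrable (f k) P)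
    (h0 : ∀ k ω, 0 ≤ f k ω) {b : ℕ → ℝ} (hb : Summable b) (hfb : ∀ k, ∫ ω, f k ω ∂P ≤ b k) :
    ∀ᵐ ω ∂P, Summable fun k => f k ω := by
  have hb0 : ∀ k, 0 ≤ b k := fun k => (integral_nonneg (h0 k)).trans (hfb k)
  have h1 : ∫⁻ ω, ∑' k, ENNReal.ofReal (f k ω) ∂P ≠ ⊤ := by
    rw [lintegral_tsum fun k => (hf k).1.aemeasurable.ennreal_ofReal]
    refine ne_top_of_le_ne_top (hb.tsum_ofReal_ne_top) (ENNReal.tsum_le_tsum fun k => ?_)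
    rw [← ofReal_integral_eq_lintegral_ofReal (hf k) (.of_forall (h0 k))]
    exact ENNReal.ofReal_le_ofReal (hfb k)
  have h2 := ae_lt_top' (AEMeasurable.tsum fun k =>
    (hf k).1.aemeasurable.ennreal_ofReal) h1
  filter_upwards [h2] with ω hω
  have := ENNReal.summable_toReal hω.ne
  simpa [ENNReal.toReal_ofReal (h0 _ ω)] using this

section LawOfLargeNumbers

variable {Ω : Type*} [MeasurableSpace Ω] {P : Measure Ω} [IsProbabilityMeasure P]

theorem integrable_of_mem_Icc {f : Ω → ℝ} (hf : Measurable f) (h : ∀ ω, f ω ∈ Set.Icc (0 : ℝ) 1) :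
    Integrable f P :=
  .of_bound hf.aestronglyMeasurable 1 (.of_forall fun ω => by
    rw [Real.norm_eq_abs, abs_le]; constructor <;> linarith [(h ω).1, (h ω).2])

/-- Of the `m * n` products, `m` are diagonal and contribute `a` each; the others contribute `c`. -/
theorem integral_sum_mul_sum {ξ : ℕ → Ω → ℝ} (hm : ∀ i, Measurable (ξ i))
    (h : ∀ i ω, ξ i ω ∈ Set.Icc (0 : ℝ) 1) {a c : ℝ} (ha : ∀ i, ∫ ω, ξ i ω * ξ i ω ∂P = a)
    (hc : ∀ i j, i ≠ j → ∫ ω, ξ i ω * ξ j ω ∂P = c) {m n : ℕ} (hmn : m ≤ n) :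
    ∫ ω, (∑ i ∈ Finset.range m, ξ i ω) * (∑ j ∈ Finset.range n, ξ j ω) ∂P =
      m * (a - c) + m * n * c := by
  have hint : ∀ i j, Integrable (fun ω => ξ i ω * ξ j ω) P := fun i j =>
    integrable_of_mem_Icc ((hm i).mul (hm j)) fun ω =>
      ⟨mul_nonneg (h i ω).1 (h j ω).1, mul_le_one₀ (h i ω).2 (h j ω).1 (h j ω).2⟩
  simp_rw [Finset.sum_mul_sum]
  rw [integral_finsetSum _ fun i _ => integrable_finsetSum _ fun j _ => hint i j]
  have : ∀ i ∈ Finset.range m, ∫ ω, ∑ j ∈ Finset.range n, ξ i ω * ξ j ω ∂P = (a - c) + n * c := by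
    intro i hi
    rw [integral_finsetSum _ fun j _ => hint i j]
    have h1 : ∀ j, ∫ ω, ξ i ω * ξ j ω ∂P = (if j = i then a - c else 0) + c := by
      intro j
      split_ifs with hj
      · subst hj; rw [ha]; ring
      · rw [hc i j (Ne.symm hj)]; ring
    simp_rw [h1]
    have hin : i < n := (Finset.mem_range.1 hi).trans_le hmn
    simp [Finset.sum_add_distrib, hin]
  rw [Finset.sum_congr rfl this]
  simp only [Finset.sum_const, Finset.card_range, nsmul_eq_mul]
  ring

/-- Expanding the square, the integral is exactly `(a - c) * (1 / m - 1 / n)`, and `0 ≤ c ≤ a ≤ 1`.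
-/
theorem integral_sq_average_sub {ξ : ℕ → Ω → ℝ} (hm : ∀ i, Measurable (ξ i))
    (h : ∀ i ω, ξ i ω ∈ Set.Icc (0 : ℝ) 1) {a c : ℝ} (ha : ∀ i, ∫ ω, ξ i ω * ξ i ω ∂P = a)
    (hc : ∀ i j, i ≠ j → ∫ ω, ξ i ω * ξ j ω ∂P = c) {m n : ℕ} (hm0 : 0 < m) (hmn : m ≤ n) :
    ∫ ω, ((∑ i ∈ Finset.range m, ξ i ω) / m - (∑ i ∈ Finset.range n, ξ i ω) / n) ^ 2 ∂P ≤
      1 / m := by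
  have hint : ∀ k l : ℕ, Integrable
      (fun ω => (∑ i ∈ Finset.range k, ξ i ω) * (∑ j ∈ Finset.range l, ξ j ω)) P := by
    intro k l
    simp_rw [Finset.sum_mul_sum]
    exact integrable_finsetSum _ fun i _ => integrable_finsetSum _ fun j _ =>
      integrable_of_mem_Icc ((hm i).mul (hm j)) fun ω =>
        ⟨mul_nonneg (h i ω).1 (h j ω).1, mul_le_one₀ (h i ω).2 (h j ω).1 (h j ω).2⟩
  have hn0 : 0 < n := hm0.trans_le hmn
  have hmR : (0 : ℝ) < m := by exact_mod_cast hm0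
  have hnR : (0 : ℝ) < n := by exact_mod_cast hn0
  have hexp : ∀ ω, ((∑ i ∈ Finset.range m, ξ i ω) / m - (∑ i ∈ Finset.range n, ξ i ω) / n) ^ 2 =
      (1 / (m : ℝ) ^ 2) * ((∑ i ∈ Finset.range m, ξ i ω) * (∑ j ∈ Finset.range m, ξ j ω)) -
      (2 / (m * n : ℝ)) * ((∑ i ∈ Finset.range m, ξ i ω) * (∑ j ∈ Finset.range n, ξ j ω)) +
      (1 / (n : ℝ) ^ 2) * ((∑ i ∈ Finset.range n, ξ i ω) * (∑ j ∈ Finset.range n, ξ j ω)) := by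
    intro ω
    field_simp
    ring
  simp_rw [hexp]
  have hI : ∀ {u v w : Ω → ℝ}, Integrable u P → Integrable v P → Integrable w P →
      ∫ ω, (u ω - v ω + w ω) ∂P = ∫ ω, u ω ∂P - ∫ ω, v ω ∂P + ∫ ω, w ω ∂P := by
    intro u v w hu hv hw
    have huv : Integrable (fun ω => u ω - v ω) P := hu.sub hv
    rw [integral_add huv hw, integral_sub hu hv]
  rw [hI ((hint m m).const_mul _) ((hint m n).const_mul _) ((hint n n).const_mul _),
    integral_const_mul, integral_const_mul, integral_const_mul,
    integral_sum_mul_sum hm h ha hc le_rfl, integral_sum_mul_sum hm h ha hc hmn,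
    integral_sum_mul_sum hm h ha hc le_rfl]
  have ha1 : a ≤ 1 := by
    rw [← ha 0]
    calc _ ≤ ∫ _ω, (1 : ℝ) ∂P := integral_mono_of_nonneg
            (.of_forall fun ω => mul_nonneg (h 0 ω).1 (h 0 ω).1) (integrable_const _)
            (.of_forall fun ω => mul_le_one₀ (h 0 ω).2 (h 0 ω).1 (h 0 ω).2)
      _ = 1 := by simp
  have ha0 : 0 ≤ a := by
    rw [← ha 0]
    exact integral_nonneg fun ω => mul_nonneg (h 0 ω).1 (h 0 ω).1
  have hc0 : 0 ≤ c := by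
    rw [← hc 0 1 (by norm_num)]
    exact integral_nonneg fun ω => mul_nonneg (h 0 ω).1 (h 1 ω).1
  -- This is `0 ≤ E (ξ 0 - ξ 1) ^ 2 = 2 * (a - c)`.
  have hc1 : c ≤ a := by
    have h1 : ∫ ω, (ξ 0 ω * ξ 0 ω - 2 * (ξ 0 ω * ξ 1 ω) + ξ 1 ω * ξ 1 ω) ∂P = a - 2 * c + a := by
      have hi : ∀ i j, Integrable (fun ω => ξ i ω * ξ j ω) P := fun i j =>
        integrable_of_mem_Icc ((hm i).mul (hm j)) fun ω =>
          ⟨mul_nonneg (h i ω).1 (h j ω).1, mul_le_one₀ (h i ω).2 (h j ω).1 (h j ω).2⟩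
      rw [hI (hi 0 0) ((hi 0 1).const_mul _) (hi 1 1), integral_const_mul, ha, ha, hc 0 1 (by norm_num)]
    have h2 : 0 ≤ ∫ ω, (ξ 0 ω * ξ 0 ω - 2 * (ξ 0 ω * ξ 1 ω) + ξ 1 ω * ξ 1 ω) ∂P :=
      integral_nonneg fun ω => by
        have := sq_nonneg (ξ 0 ω - ξ 1 ω)
        simp only [Pi.zero_apply]
        nlinarith
    linarith
  have e : 1 / (m : ℝ) ^ 2 * (m * (a - c) + m * m * c) -
      2 / (m * n : ℝ) * (m * (a - c) + m * n * c) +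
      1 / (n : ℝ) ^ 2 * (n * (a - c) + n * n * c) = (a - c) * (1 / m) - (a - c) * (1 / n) := by
    field_simp
    ring
  rw [e]
  have h1 : 0 ≤ (a - c) * (1 / (n : ℝ)) := mul_nonneg (by linarith) (by positivity)
  have h2 : (a - c) * (1 / (m : ℝ)) ≤ 1 * (1 / m) :=
    mul_le_mul_of_nonneg_right (by linarith) (by positivity)
  linarith

/-- The law of large numbers for variables in `[0, 1]` with the second moments of an exchangeable
sequence. -/
theorem ae_exists_tendsto_average {ξ : ℕ → Ω → ℝ} (hm : ∀ i, Measurable (ξ i))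
    (h : ∀ i ω, ξ i ω ∈ Set.Icc (0 : ℝ) 1) {a c : ℝ} (ha : ∀ i, ∫ ω, ξ i ω * ξ i ω ∂P = a)
    (hc : ∀ i j, i ≠ j → ∫ ω, ξ i ω * ξ j ω ∂P = c) :
    ∀ᵐ ω ∂P, ∃ l, Tendsto (fun n : ℕ => (∑ i ∈ Finset.range n, ξ i ω) / n) atTop (𝓝 l) := by
  -- The subsequence is sparse enough for the L¹ norms of the increments of the averages, at most `1
  -- / (k + 1) ^ 2`, to be summable, and dense enough for `κ (k + 1) / κ k → 1`. Monotonicity of the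
  -- partial sums then fills the gaps.
  let κ : ℕ → ℕ := fun k => (k + 1) ^ 4
  let A : ℕ → Ω → ℝ := fun n ω => (∑ i ∈ Finset.range n, ξ i ω) / n
  have hA : ∀ n, Measurable (A n) := fun n => (Finset.measurable_sum _ fun i _ => hm i).div_const _
  have hAI : ∀ n ω, A n ω ∈ Set.Icc (0 : ℝ) 1 := by
    intro n ω
    constructor
    · exact div_nonneg (Finset.sum_nonneg fun i _ => (h i ω).1) (by positivity)
    · refine div_le_one_of_le₀ ?_ (by positivity)
      calc _ ≤ ∑ i ∈ Finset.range n, (1 : ℝ) := Finset.sum_le_sum fun i _ => (h i ω).2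
        _ = n := by simp
  have hAint : ∀ n, Integrable (A n) P := fun n => integrable_of_mem_Icc (hA n) (hAI n)
  have hsq : ∀ k, ∫ ω, (A (κ k) ω - A (κ (k + 1)) ω) ^ 2 ∂P ≤ 1 / (k + 1 : ℝ) ^ 4 := by
    intro k
    have := integral_sq_average_sub (P := P) hm h ha hc (m := κ k) (n := κ (k + 1))
      (by positivity) (Nat.pow_le_pow_left (by omega) 4)
    simpa [κ, A] using this
  have hsqint : ∀ k, Integrable (fun ω => (A (κ k) ω - A (κ (k + 1)) ω) ^ 2) P := by
    intro k
    refine .of_bound (((hA _).sub (hA _)).pow_const 2).aestronglyMeasurable 1 (.of_forall ?_)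
    intro ω
    rw [Real.norm_eq_abs, abs_of_nonneg (sq_nonneg _), sq_le_one_iff_abs_le_one, abs_le]
    constructor <;> linarith [(hAI (κ k) ω).1, (hAI (κ k) ω).2, (hAI (κ (k + 1)) ω).1,
      (hAI (κ (k + 1)) ω).2]
  have habs : ∀ k, ∫ ω, |A (κ k) ω - A (κ (k + 1)) ω| ∂P ≤ 1 / (k + 1 : ℝ) ^ 2 := by
    intro k
    -- The weight `t` balances the two terms of `|D| ≤ t / 2 * D ^ 2 + 1 / (2 * t)`, given that `D ^
    -- 2` has mean at most `1 / t ^ 2`.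
    set t : ℝ := (k + 1 : ℝ) ^ 2
    have ht : 0 < t := by positivity
    have ht4 : (k + 1 : ℝ) ^ 4 = t ^ 2 := by simp only [t]; ring
    calc ∫ ω, |A (κ k) ω - A (κ (k + 1)) ω| ∂P
        ≤ ∫ ω, ((t / 2) * (A (κ k) ω - A (κ (k + 1)) ω) ^ 2 + 1 / (2 * t)) ∂P := by
          refine integral_mono ((hAint _).sub (hAint _)).abs
            (((hsqint k).const_mul _).add (integrable_const _)) fun ω => ?_
          simp only
          set D := A (κ k) ω - A (κ (k + 1)) ω
          have e : t / 2 * D ^ 2 + 1 / (2 * t) - |D| = (t * |D| - 1) ^ 2 / (2 * t) := by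
            rw [← sq_abs D]; field_simp; ring
          have : 0 ≤ (t * |D| - 1) ^ 2 / (2 * t) := by positivity
          linarith
      _ = (t / 2) * ∫ ω, (A (κ k) ω - A (κ (k + 1)) ω) ^ 2 ∂P + 1 / (2 * t) := by
          rw [integral_add ((hsqint k).const_mul _) (integrable_const _), integral_const_mul]
          simp
      _ ≤ (t / 2) * (1 / t ^ 2) + 1 / (2 * t) := by
          have := hsq k
          rw [ht4] at this
          gcongr
      _ = 1 / t := by field_simp; ring
  have hsum : Summable fun k : ℕ => 1 / (k + 1 : ℝ) ^ 2 := by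
    have := (summable_nat_add_iff 1).2 (Real.summable_one_div_nat_pow.2 (le_refl 2))
    simpa using this
  filter_upwards [ae_summable_of_summable_integral (P := P)
    (fun k => ((hAint (κ k)).sub (hAint (κ (k + 1)))).abs) (fun k ω => abs_nonneg _) hsum habs]
    with ω hω
  obtain ⟨l, hl⟩ := cauchySeq_tendsto_of_complete
    (cauchySeq_of_summable_dist (f := fun k => A (κ k) ω) hω)
  refine ⟨l, tendsto_div_of_monotone_of_exists_subseq_tendsto_div
    (fun n => ∑ i ∈ Finset.range n, ξ i ω) l ?_ fun r hr => ⟨κ, ?_, ?_, hl⟩⟩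
  · exact monotone_nat_of_le_succ fun n => by
      rw [Finset.sum_range_succ]
      linarith [(h n ω).1]
  · have h1 : Tendsto (fun n : ℕ => (1 + 1 / ((n : ℝ) + 1)) ^ 4) atTop (𝓝 ((1 + 0) ^ 4)) :=
      (tendsto_const_nhds.add tendsto_one_div_add_atTop_nhds_zero_nat).pow 4
    rw [add_zero, one_pow] at h1
    filter_upwards [h1.eventually_lt_const hr] with n hn
    have e : (κ (n + 1) : ℝ) = (1 + 1 / ((n : ℝ) + 1)) ^ 4 * κ n := by
      simp only [κ]
      push_cast
      field_simp
    rw [e]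
    gcongr
  · refine tendsto_atTop_mono (fun n => ?_) (tendsto_add_atTop_nat 1)
    exact Nat.le_self_pow (by norm_num) _

end LawOfLargeNumbers

/-! ### Finite permutations, singletons and conservation of mass. -/

/-- A finite injective sequence of integers extends to a permutation with finite support. -/
theorem exists_perm_extending (f : ℕ → ℕ) (n : ℕ) (hf : Set.InjOn f (Set.Iio n)) :
    ∃ σ : Equiv.Perm ℕ, {k | σ k ≠ k}.Finite ∧ ∀ k < n, σ k = f k := by
  induction n with
  | zero => exact ⟨1, by simp, by simp⟩
  | succ n ih =>
    obtain ⟨σ, hσ, h⟩ := ih (hf.mono (Set.Iio_subset_Iio n.le_succ))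
    -- The swap is applied before `σ` and sends `n` to the preimage of `f n`. It fixes every `k <
    -- n`, because `f k ≠ f n`.
    refine ⟨σ * Equiv.swap n (σ.symm (f n)), ?_, fun k hk => ?_⟩
    · refine (hσ.union (Set.toFinite {n, σ.symm (f n)})).subset fun k hk => ?_
      by_contra hk'
      simp only [Set.mem_union, Set.mem_ofPred_eq, Set.mem_insert_iff, Set.mem_singleton_iff,
        not_or, not_not] at hk'
      refine hk ?_
      rw [Equiv.Perm.mul_apply, Equiv.swap_apply_of_ne_of_ne hk'.2.1 hk'.2.2, hk'.1]
    · rcases Nat.lt_succ_iff_lt_or_eq.1 hk with hk' | rfl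
      · rw [Equiv.Perm.mul_apply, Equiv.swap_apply_of_ne_of_ne hk'.ne, h k hk']
        intro hks
        have : f k = f n := by rw [← h k hk', hks, Equiv.apply_symm_apply]
        exact hk'.ne (hf hk n.lt_succ_self this)
      · simp

open Classical in
/-- The real number `1` or `0` according to whether `p` holds. -/
noncomputable def ind (p : Prop) : ℝ := if p then 1 else 0

theorem ind_of {p : Prop} (h : p) : ind p = 1 := if_pos h

theorem ind_of_not {p : Prop} (h : ¬ p) : ind p = 0 := if_neg h

theorem ind_mem_Icc (p : Prop) : ind p ∈ Set.Icc (0 : ℝ) 1 := by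
  unfold ind; split_ifs <;> simp

theorem ind_nonneg (p : Prop) : 0 ≤ ind p := (ind_mem_Icc p).1

theorem ind_le_one (p : Prop) : ind p ≤ 1 := (ind_mem_Icc p).2

theorem measurable_ind {Ω : Type*} [MeasurableSpace Ω] {p : Ω → Prop}
    (h : MeasurableSet {ω | p ω}) : Measurable fun ω => ind (p ω) := by
  classical
  exact Measurable.ite h measurable_const measurable_const

theorem average_ind_mem_Icc (p : ℕ → Prop) (n : ℕ) :
    (∑ j ∈ Finset.range n, ind (p j)) / (n : ℝ) ∈ Set.Icc (0 : ℝ) 1 := by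
  constructor
  · exact div_nonneg (Finset.sum_nonneg fun i _ => ind_nonneg _) (by positivity)
  · refine div_le_one_of_le₀ ?_ (by positivity)
    calc _ ≤ ∑ i ∈ Finset.range n, (1 : ℝ) := Finset.sum_le_sum fun i _ => ind_le_one _
      _ = n := by simp

theorem hasFreq_iff_ind {B : Set ℕ} {a : ℝ} : HasFreq B a ↔
    Tendsto (fun n : ℕ => (∑ j ∈ Finset.range n, ind (j ∈ B)) / (n : ℝ)) atTop (𝓝 a) := by
  classical
  rw [hasFreq_iff]
  unfold ind
  convert! Iff.rfl

/-- The index `0` contributes at most `1 / (n + 1)`. The law of large numbers can thus be applied to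
the positive integers when `0` plays a special role. -/
theorem HasFreq.of_shift {B : Set ℕ} {a : ℝ} (h : HasFreq {j | j + 1 ∈ B} a) : HasFreq B a := by
  rw [hasFreq_iff_ind] at h ⊢
  rw [← tendsto_add_atTop_iff_nat 1]
  have h1 := (tendsto_one_div_add_atTop_nhds_zero_nat (𝕜 := ℝ)).const_mul (ind (0 ∈ B))
  have h2 := h1.add (h.mul (tendsto_natCast_div_add_atTop (1 : ℝ)))
  simp only [mul_zero, zero_add, mul_one] at h2
  refine h2.congr fun n => ?_
  rw [Finset.sum_range_succ']
  rcases Nat.eq_zero_or_pos n with rfl | hn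
  · simp
  · have : (n : ℝ) ≠ 0 := by positivity
    push_cast
    simp only [Set.mem_ofPred_eq]
    field_simp
    ring

/-- Once `n` exceeds the support, `σ` permutes the integers below `n`. -/
theorem eventually_ncard_preimage_perm {σ : Equiv.Perm ℕ} (hσ : {n : ℕ | σ n ≠ n}.Finite)
    (B : Set ℕ) : ∀ᶠ n in atTop, (σ ⁻¹' B ∩ Set.Iio n).ncard = (B ∩ Set.Iio n).ncard := by
  obtain ⟨M, hM⟩ := hσ.bddAbove
  filter_upwards [eventually_gt_atTop M] with n hn
  have key : ∀ k, σ k < n ↔ k < n := by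
    intro k
    by_cases hk : σ k = k
    · rw [hk]
    · have h1 : k ≤ M := hM hk
      have h2 : σ k ≤ M := hM (fun h => hk (σ.injective h))
      omega
  have : B ∩ Set.Iio n = σ '' (σ ⁻¹' B ∩ Set.Iio n) := by
    ext k
    obtain ⟨l, rfl⟩ := σ.surjective k
    rw [σ.injective.mem_set_image]
    simp [key]
  rw [this, Set.ncard_image_of_injective _ σ.injective]

namespace MarkedPartition

theorem eventually_ratio_act {σ : Equiv.Perm ℕ} (hσ : {n : ℕ | σ n ≠ n}.Finite)
    (x : MarkedPartition) (i : ℕ) :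
    (x.act σ).ratio i =ᶠ[atTop] x.ratio (σ i) := by
  filter_upwards [eventually_ncard_preimage_perm hσ (x.block (σ i))] with n hn
  unfold ratio
  rw [← hn]
  rfl

theorem freq_act {σ : Equiv.Perm ℕ} (hσ : {n : ℕ | σ n ≠ n}.Finite)
    (x : MarkedPartition) (i : ℕ) : (x.act σ).freq i = x.freq (σ i) := by
  unfold freq limUnder
  rw [Filter.map_congr (eventually_ratio_act hσ x i)]

theorem ratio_eq (x : MarkedPartition) (i n : ℕ) :
    x.ratio i n = (∑ j ∈ Finset.range n, ind (x.part j i)) / (n : ℝ) := by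
  classical
  unfold ratio ind
  rw [ncard_inter_Iio]
  congr 1

/-- The block of `i` is a singleton. -/
def IsSingleton (x : MarkedPartition) (i : ℕ) : Prop := ∀ j, x.part j i → j = i

theorem measurableSet_isSingleton (i : ℕ) :
    MeasurableSet {x : MarkedPartition | x.IsSingleton i} := by
  simp only [IsSingleton, imp_iff_not_or, Set.ofPred_forall, Set.ofPred_or]
  exact .iInter fun j => (measurableSet_part j i).compl.union (.const _)

theorem IsSingleton.block_eq {x : MarkedPartition} {i : ℕ} (h : x.IsSingleton i) :
    x.block i = {i} := by
  ext j
  exact ⟨h j, fun hj => (Set.mem_singleton_iff.1 hj) ▸ x.mem_block_self i⟩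

theorem IsSingleton.freq_eq_zero {x : MarkedPartition} {i : ℕ} (h : x.IsSingleton i) :
    x.freq i = 0 :=
  freq_eq (h.block_eq ▸ (Set.finite_singleton i).hasFreq)

theorem isSingleton_act (σ : Equiv.Perm ℕ) (x : MarkedPartition) (i : ℕ) :
    (x.act σ).IsSingleton i ↔ x.IsSingleton (σ i) := by
  constructor
  · intro h j hj
    obtain ⟨l, rfl⟩ := σ.surjective j
    rw [h l hj]
  · exact fun h j hj => σ.injective (h (σ j) hj)

/-- The proportion of the integers below `n` that are in the block of `i`, if this block has several
elements and its first element is `i`. -/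
noncomputable def firstRatio (x : MarkedPartition) (n i : ℕ) : ℝ :=
  ind (x.IsFirst i ∧ ¬ x.IsSingleton i) * x.ratio i n

theorem firstRatio_nonneg (x : MarkedPartition) (n i : ℕ) : 0 ≤ x.firstRatio n i :=
  mul_nonneg (ind_nonneg _) (x.ratio_nonneg i n)

theorem IsFirst.ratio_eq_zero {x : MarkedPartition} {i n : ℕ} (hi : x.IsFirst i) (h : n ≤ i) :
    x.ratio i n = 0 := by
  rw [ratio_eq, Finset.sum_eq_zero, zero_div]
  exact fun j hj => ind_of_not (hi j ((Finset.mem_range.1 hj).trans_le h))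

theorem firstRatio_eq_zero {x : MarkedPartition} {i n : ℕ} (h : n ≤ i) : x.firstRatio n i = 0 := by
  unfold firstRatio
  by_cases hi : x.IsFirst i
  · rw [hi.ratio_eq_zero h, mul_zero]
  · rw [ind_of_not fun h => hi h.1, zero_mul]

/-- An integer `j < n` is either a singleton or in exactly one block with several elements, whose
first element is at most `j`, hence counted. -/
theorem singletons_add_sum_firstRatio (x : MarkedPartition) {n : ℕ} (hn : 0 < n) :
    (∑ j ∈ Finset.range n, ind (x.IsSingleton j)) / (n : ℝ) +
      ∑ i ∈ Finset.range n, x.firstRatio n i = 1 := by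
  have h1 : ∀ j ∈ Finset.range n, ind (x.IsSingleton j) +
      ∑ i ∈ Finset.range n, ind (x.IsFirst i ∧ ¬ x.IsSingleton i) * ind (x.part j i) = 1 := by
    intro j hj
    by_cases hs : x.IsSingleton j
    · rw [ind_of hs, Finset.sum_eq_zero, add_zero]
      intro i _
      by_cases hij : x.part j i
      · have : i = j := hs i (x.part.symm' hij)
        subst this
        rw [ind_of_not fun h => h.2 hs, zero_mul]
      · rw [ind_of_not hij, mul_zero]
    · obtain ⟨k, hk, hkj⟩ := x.exists_isFirst j
      have hks : ¬ x.IsSingleton k := by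
        intro h
        have : j = k := h j (x.part.symm' hkj)
        exact hs (this ▸ h)
      have hkn : k < n := by
        by_contra h
        exact hk j ((Finset.mem_range.1 hj).trans_le (not_lt.1 h)) (x.part.symm' hkj)
      rw [ind_of_not hs, zero_add, Finset.sum_eq_single k]
      · rw [ind_of ⟨hk, hks⟩, ind_of (x.part.symm' hkj), one_mul]
      · intro i _ hik
        by_cases hij : x.part j i
        · by_cases hi : x.IsFirst i
          · exact absurd (hi.eq hk (x.part.symm' (x.part.trans' hkj hij))) hik
          · rw [ind_of_not fun h => hi h.1, zero_mul]
        · rw [ind_of_not hij, mul_zero]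
      · exact fun h => absurd (Finset.mem_range.2 hkn) h
  have h2 : ∑ j ∈ Finset.range n, (ind (x.IsSingleton j) + ∑ i ∈ Finset.range n,
      ind (x.IsFirst i ∧ ¬ x.IsSingleton i) * ind (x.part j i)) =
      ∑ j ∈ Finset.range n, (1 : ℝ) := Finset.sum_congr rfl h1
  rw [Finset.sum_add_distrib, Finset.sum_comm (s := Finset.range n)] at h2
  simp only [Finset.sum_const, Finset.card_range, nsmul_eq_mul, mul_one] at h2
  have hn' : (n : ℝ) ≠ 0 := by positivity
  have h3 : ∑ i ∈ Finset.range n, x.firstRatio n i = (∑ i ∈ Finset.range n,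
      ∑ j ∈ Finset.range n, ind (x.IsFirst i ∧ ¬ x.IsSingleton i) * ind (x.part j i)) / n := by
    rw [Finset.sum_div]
    refine Finset.sum_congr rfl fun i _ => ?_
    rw [firstRatio, ratio_eq, ← Finset.mul_sum, mul_div_assoc]
  rw [h3, ← add_div, h2, div_self hn']

theorem tendsto_firstRatio {x : MarkedPartition} (hx : x.HasAsymptoticFreqs) (i : ℕ) :
    Tendsto (fun n => x.firstRatio n i) atTop (𝓝 (x.firstFreq i)) := by
  unfold firstRatio firstFreq
  have h := (hx.tendsto i).const_mul (ind (x.IsFirst i ∧ ¬ x.IsSingleton i))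
  convert! h using 2
  split_ifs with hi
  · by_cases hs : x.IsSingleton i
    · rw [hs.freq_eq_zero, mul_zero]
    · rw [ind_of ⟨hi, hs⟩, one_mul]
  · rw [ind_of_not fun h => hi h.1, zero_mul]

/-- Fatou's inequality for the conservation identity `singletons_add_sum_firstRatio`; mass may be
lost in the limit. -/
theorem add_tsum_firstFreq_le_one {x : MarkedPartition} (hx : x.HasAsymptoticFreqs) {d : ℝ}
    (hd : Tendsto (fun n : ℕ => (∑ j ∈ Finset.range n, ind (x.IsSingleton j)) / (n : ℝ)) atTop
      (𝓝 d)) : d + ∑' i, x.firstFreq i ≤ 1 := by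
  have h : ∑' i, x.firstFreq i ≤ 1 - d := by
    refine (summable_firstFreq hx).tsum_le_of_sum_le fun S => ?_
    refine le_of_tendsto_of_tendsto (tendsto_finsetSum S fun i _ => tendsto_firstRatio hx i)
      (hd.const_sub 1) ?_
    filter_upwards [eventually_gt_atTop 0] with n hn
    have h1 := x.singletons_add_sum_firstRatio hn
    have h2 : ∑ i ∈ S, x.firstRatio n i ≤ ∑ i ∈ Finset.range n, x.firstRatio n i := by
      classical
      rw [← Finset.sum_filter_ne_zero]
      refine Finset.sum_le_sum_of_subset_of_nonneg (fun i hi => ?_)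
        fun i _ _ => x.firstRatio_nonneg n i
      by_contra hin
      exact (Finset.mem_filter.1 hi).2
        (firstRatio_eq_zero (not_lt.1 fun h => hin (Finset.mem_range.2 h)))
    linarith
  linarith

/-- Only finitely many blocks have frequency at least `ε`. The cutoff turns the average into a
finite sum, whose limit is immediate. -/
theorem average_freq_ge_eq {x : MarkedPartition} (hx : x.HasAsymptoticFreqs) {ε : ℝ} (hε : 0 < ε)
    (n : ℕ) : (∑ j ∈ Finset.range n, ind (ε ≤ x.freq j)) / (n : ℝ) =
      ∑ k ∈ (finite_freq_ge hx hε).toFinset, x.ratio k n := by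
  simp_rw [ratio_eq]
  rw [← Finset.sum_div, Finset.sum_comm]
  congr 1
  refine Finset.sum_congr rfl fun j _ => ?_
  obtain ⟨k, hk, hkj⟩ := x.exists_isFirst j
  by_cases h : ε ≤ x.freq j
  · rw [ind_of h, Finset.sum_eq_single k, ind_of (x.part.symm' hkj)]
    · intro i hi hik
      refine ind_of_not fun hij => hik ?_
      exact ((Set.Finite.mem_toFinset _).1 hi).1.eq hk (x.part.symm' (x.part.trans' hkj hij))
    · intro hk'
      have hkf : ε ≤ x.freq k := by rwa [freq_congr hkj]
      exact absurd ((Set.Finite.mem_toFinset (finite_freq_ge hx hε)).2 ⟨hk, hkf⟩) hk'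
  · rw [ind_of_not h, Finset.sum_eq_zero]
    intro i hi
    refine ind_of_not fun hij => h ?_
    rw [freq_congr hij]
    exact ((Set.Finite.mem_toFinset _).1 hi).2

theorem sum_freq_ge_le_tsum {x : MarkedPartition} (hx : x.HasAsymptoticFreqs) {ε : ℝ}
    (hε : 0 < ε) :
    ∑ k ∈ (finite_freq_ge hx hε).toFinset, x.freq k ≤ ∑' i, x.firstFreq i := by
  refine le_trans (le_of_eq (Finset.sum_congr rfl fun k hk => ?_))
    ((summable_firstFreq hx).sum_le_tsum _ fun i _ => firstFreq_nonneg hx i)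
  exact (if_pos ((Set.Finite.mem_toFinset _).1 hk).1).symm

theorem measurable_firstFreq (i : ℕ) : Measurable fun x : MarkedPartition => x.firstFreq i := by
  classical
  exact Measurable.ite (measurableSet_isFirst i) (measurable_freq i) measurable_const

end MarkedPartition

/-! ### Almost sure properties under an invariant law. -/

/-- The law `μ` is invariant under the permutations with finite support. -/
def InvariantLaw (μ : Measure NonDegPartition) : Prop :=
  ∀ σ : Equiv.Perm ℕ, {n : ℕ | σ n ≠ n}.Finite → μ.map (NonDegPartition.act σ) = μ

theorem finite_swap_ne (a b : ℕ) : {n : ℕ | Equiv.swap a b n ≠ n}.Finite := by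
  refine (Set.toFinite {a, b}).subset fun k hk => ?_
  by_contra h
  simp only [Set.mem_insert_iff, Set.mem_singleton_iff, not_or] at h
  exact hk (Equiv.swap_apply_of_ne_of_ne h.1 h.2)

namespace InvariantLaw

variable {μ : Measure NonDegPartition}

theorem integral_act (hμ : InvariantLaw μ) {σ : Equiv.Perm ℕ} (hσ : {n : ℕ | σ n ≠ n}.Finite)
    {F : NonDegPartition → ℝ} (hF : Measurable F) :
    ∫ x, F (x.act σ) ∂μ = ∫ x, F x ∂μ := by
  conv_rhs => rw [← hμ σ hσ]
  exact (integral_map (NonDegPartition.measurable_act σ).aemeasurable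
    hF.aestronglyMeasurable).symm

theorem integral_eq_of_act (hμ : InvariantLaw μ) {σ : Equiv.Perm ℕ}
    (hσ : {n : ℕ | σ n ≠ n}.Finite) {F G : NonDegPartition → ℝ} (hF : Measurable F)
    (h : ∀ x, F (x.act σ) = G x) : ∫ x, G x ∂μ = ∫ x, F x ∂μ := by
  rw [← hμ.integral_act hσ hF]
  exact integral_congr_ae (.of_forall fun x => (h x).symm)

theorem ae_act (hμ : InvariantLaw μ) {σ : Equiv.Perm ℕ} (hσ : {n : ℕ | σ n ≠ n}.Finite)
    {p : NonDegPartition → Prop} (hp : ∀ᵐ x ∂μ, p x) : ∀ᵐ x ∂μ, p (x.act σ) := by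
  rw [← hμ σ hσ] at hp
  exact ae_of_ae_map (NonDegPartition.measurable_act σ).aemeasurable hp

theorem exists_perm_three {i j k : ℕ} (hij : i ≠ j) (hik : i ≠ k) (hjk : j ≠ k) :
    ∃ σ : Equiv.Perm ℕ, {n | σ n ≠ n}.Finite ∧ σ 0 = i ∧ σ 1 = j ∧ σ 2 = k := by
  obtain ⟨σ, hσ, h⟩ := exists_perm_extending
    (fun n => if n = 0 then i else if n = 1 then j else k) 3 (by
      intro a ha b hb hab
      simp only [Set.mem_Iio] at ha hb
      interval_cases a <;> interval_cases b <;> simp_all)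
  exact ⟨σ, hσ, by simpa using h 0, by simpa using h 1, by simpa using h 2⟩

variable [IsProbabilityMeasure μ]

/-- The indicators that `j + 1` is in the block of `0` have the required second moments, by
permutations that fix `0`. -/
theorem ae_exists_tendsto_ratio_zero (hμ : InvariantLaw μ) :
    ∀ᵐ x ∂μ, ∃ a, Tendsto (x.1.ratio 0) atTop (𝓝 a) := by
  have hmeas : ∀ i j, Measurable fun x : NonDegPartition => ind (x.1.part i j) := fun i j =>
    measurable_ind (NonDegPartition.measurableSet_part i j)
  have key := ae_exists_tendsto_average (P := μ)
    (ξ := fun j x => ind (x.1.part (j + 1) 0)) (fun j => hmeas _ _) (fun j x => ind_mem_Icc _)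
    (a := ∫ x, ind (x.1.part 1 0) * ind (x.1.part 1 0) ∂μ)
    (c := ∫ x, ind (x.1.part 1 0) * ind (x.1.part 2 0) ∂μ) ?_ ?_
  · filter_upwards [key] with x ⟨a, ha⟩
    refine ⟨a, MarkedPartition.hasFreq_block_iff.1 (HasFreq.of_shift ?_)⟩
    rw [hasFreq_iff_ind]
    exact ha
  · intro i
    obtain ⟨σ, hσ, h0, h1, -⟩ := exists_perm_three (i := 0) (j := i + 1) (k := i + 2)
      (by omega) (by omega) (by omega)
    refine hμ.integral_eq_of_act hσ ((hmeas 1 0).mul (hmeas 1 0)) fun x => ?_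
    change ind (x.1.part (σ 1) (σ 0)) * ind (x.1.part (σ 1) (σ 0)) = _
    rw [h0, h1]
  · intro i j hij
    obtain ⟨σ, hσ, h0, h1, h2⟩ := exists_perm_three (i := 0) (j := i + 1) (k := j + 1)
      (by omega) (by omega) (by omega)
    refine hμ.integral_eq_of_act hσ ((hmeas 1 0).mul (hmeas 2 0)) fun x => ?_
    change ind (x.1.part (σ 1) (σ 0)) * ind (x.1.part (σ 2) (σ 0)) = _
    rw [h0, h1, h2]

theorem ae_hasAsymptoticFreqs (hμ : InvariantLaw μ) : ∀ᵐ x ∂μ, x.1.HasAsymptoticFreqs := by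
  simp only [MarkedPartition.hasAsymptoticFreqs_iff]
  refine ae_all_iff.2 fun i => ?_
  filter_upwards [hμ.ae_act (finite_swap_ne 0 i) hμ.ae_exists_tendsto_ratio_zero] with x ⟨a, ha⟩
  refine ⟨a, ha.congr' ?_⟩
  have := MarkedPartition.eventually_ratio_act (finite_swap_ne 0 i) x.1 0
  rwa [Equiv.swap_apply_left] at this

/-- The probability `p` that `j` is in the block of `0` and this block has frequency zero is the
same for all `j ≥ 1`. Averaging over `j` bounds `p`, in the limit, by the mean of the frequency of
`0` on the event that it vanishes; so `p = 0`. -/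
theorem ae_isSingleton_zero (hμ : InvariantLaw μ) :
    ∀ᵐ x ∂μ, x.1.freq 0 = 0 → x.1.IsSingleton 0 := by
  have hmf : Measurable fun x : NonDegPartition => x.1.freq 0 :=
    (MarkedPartition.measurable_freq 0).comp measurable_subtype_coe
  have hmeas : ∀ j, Measurable fun x : NonDegPartition =>
      ind (x.1.part j 0) * ind (x.1.freq 0 = 0) := fun j =>
    (measurable_ind (NonDegPartition.measurableSet_part j 0)).mul (measurable_ind
      (measurableSet_eq_fun hmf measurable_const))
  have hI : ∀ j, ∀ x : NonDegPartition,
      ind (x.1.part j 0) * ind (x.1.freq 0 = 0) ∈ Set.Icc (0 : ℝ) 1 := fun j x =>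
    ⟨mul_nonneg (ind_nonneg _) (ind_nonneg _), mul_le_one₀ (ind_le_one _) (ind_nonneg _)
      (ind_le_one _)⟩
  have hint : ∀ j, Integrable (fun x : NonDegPartition =>
      ind (x.1.part j 0) * ind (x.1.freq 0 = 0)) μ := fun j =>
    integrable_of_mem_Icc (hmeas j) (hI j)
  set p := ∫ x, ind (x.1.part 1 0) * ind (x.1.freq 0 = 0) ∂μ
  have hp : ∀ j, 1 ≤ j → ∫ x, ind (x.1.part j 0) * ind (x.1.freq 0 = 0) ∂μ = p := by
    intro j hj
    have h0 : Equiv.swap 1 j 0 = 0 :=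
      Equiv.swap_apply_of_ne_of_ne (by norm_num) (by omega)
    refine hμ.integral_eq_of_act (finite_swap_ne 1 j) (hmeas 1) fun x => ?_
    change ind (x.1.part (Equiv.swap 1 j 1) (Equiv.swap 1 j 0)) *
      ind ((x.1.act (Equiv.swap 1 j)).freq 0 = 0) = _
    rw [MarkedPartition.freq_act (finite_swap_ne 1 j), h0, Equiv.swap_apply_left]
  have hlim : Tendsto (fun n : ℕ => ∫ x, x.1.ratio 0 n * ind (x.1.freq 0 = 0) ∂μ) atTop
      (𝓝 (∫ _x, (0 : ℝ) ∂μ)) := by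
    refine tendsto_integral_of_dominated_convergence (fun _ => 1) (fun n => ?_)
      (integrable_const _) (fun n => .of_forall fun x => ?_) ?_
    · exact (((MarkedPartition.measurable_ratio 0 n).comp measurable_subtype_coe).mul
        (measurable_ind (measurableSet_eq_fun hmf measurable_const))).aestronglyMeasurable
    · rw [Real.norm_eq_abs, abs_of_nonneg (mul_nonneg (x.1.ratio_nonneg 0 n) (ind_nonneg _))]
      exact mul_le_one₀ (x.1.ratio_le_one 0 n) (ind_nonneg _) (ind_le_one _)
    · filter_upwards [hμ.ae_hasAsymptoticFreqs] with x hx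
      have := (hx.tendsto 0).mul_const (ind (x.1.freq 0 = 0))
      convert! this using 2
      by_cases h : x.1.freq 0 = 0
      · rw [h, zero_mul]
      · rw [ind_of_not h, mul_zero]
  have hge : ∀ n : ℕ, ((n : ℝ) / ((n : ℝ) + 1)) * p ≤
      ∫ x, x.1.ratio 0 (n + 1) * ind (x.1.freq 0 = 0) ∂μ := by
    intro n
    have e : ∀ x : NonDegPartition, x.1.ratio 0 (n + 1) * ind (x.1.freq 0 = 0) =
        (1 / ((n : ℝ) + 1)) *
          ∑ j ∈ Finset.range (n + 1), ind (x.1.part j 0) * ind (x.1.freq 0 = 0) := by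
      intro x
      rw [MarkedPartition.ratio_eq, ← Finset.sum_mul]
      push_cast
      ring
    simp_rw [e]
    rw [integral_const_mul, integral_finsetSum _ fun j _ => hint j, Finset.sum_range_succ']
    rw [Finset.sum_congr rfl fun j _ => hp (j + 1) (by omega)]
    have h0 : 0 ≤ ∫ x, ind (x.1.part 0 0) * ind (x.1.freq 0 = 0) ∂μ :=
      integral_nonneg fun x => (hI 0 x).1
    simp only [Finset.sum_const, Finset.card_range, nsmul_eq_mul]
    rw [div_mul_eq_mul_div, one_div_mul_eq_div]
    gcongr
    linarith
  have hp0 : p = 0 := by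
    refine le_antisymm ?_ (integral_nonneg fun x => (hI 1 x).1)
    have h1 := (tendsto_natCast_div_add_atTop (1 : ℝ)).mul_const p
    rw [one_mul] at h1
    have h2 := le_of_tendsto_of_tendsto' h1 ((tendsto_add_atTop_iff_nat 1).2 hlim) hge
    simpa using h2
  have hall : ∀ᵐ x ∂μ, ∀ j, 1 ≤ j → ind (x.1.part j 0) * ind (x.1.freq 0 = 0) = 0 := by
    refine ae_all_iff.2 fun j => ?_
    by_cases hj : 1 ≤ j
    · have := (integral_eq_zero_iff_of_nonneg (fun x => (hI j x).1) (hint j)).1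
        ((hp j hj).trans hp0)
      filter_upwards [this] with x hx _ using hx
    · exact .of_forall fun x h => absurd h hj
  filter_upwards [hall] with x hx h0 j hj
  by_contra hne
  have := hx j (by omega)
  rw [ind_of hj, ind_of h0] at this
  norm_num at this

theorem ae_isSingleton (hμ : InvariantLaw μ) :
    ∀ᵐ x ∂μ, ∀ i, x.1.freq i = 0 → x.1.IsSingleton i := by
  refine ae_all_iff.2 fun i => ?_
  filter_upwards [hμ.ae_act (finite_swap_ne 0 i) hμ.ae_isSingleton_zero] with x hx h
  have h1 := MarkedPartition.freq_act (finite_swap_ne 0 i) x.1 0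
  have h2 := MarkedPartition.isSingleton_act (Equiv.swap 0 i) x.1 0
  rw [Equiv.swap_apply_left] at h1 h2
  exact h2.1 (hx (h1.trans h))

theorem ae_exists_tendsto_singletons (hμ : InvariantLaw μ) : ∀ᵐ x ∂μ, ∃ d,
    Tendsto (fun n : ℕ => (∑ j ∈ Finset.range n, ind (x.1.IsSingleton j)) / (n : ℝ)) atTop
      (𝓝 d) := by
  have hmeas : ∀ i, Measurable fun x : NonDegPartition => ind (x.1.IsSingleton i) := fun i =>
    (measurable_ind (MarkedPartition.measurableSet_isSingleton i)).comp measurable_subtype_coe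
  refine ae_exists_tendsto_average (P := μ)
    (ξ := fun j x => ind (x.1.IsSingleton j)) hmeas (fun j x => ind_mem_Icc _)
    (a := ∫ x, ind (x.1.IsSingleton 0) * ind (x.1.IsSingleton 0) ∂μ)
    (c := ∫ x, ind (x.1.IsSingleton 0) * ind (x.1.IsSingleton 1) ∂μ) ?_ ?_
  · intro i
    refine hμ.integral_eq_of_act (finite_swap_ne 0 i) ((hmeas 0).mul (hmeas 0)) fun x => ?_
    have h := MarkedPartition.isSingleton_act (Equiv.swap 0 i) x.1 0
    rw [Equiv.swap_apply_left] at h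
    change ind ((x.1.act _).IsSingleton 0) * ind ((x.1.act _).IsSingleton 0) = _
    rw [h]
  · intro i j hij
    obtain ⟨σ, hσ, h0, h1, -⟩ := exists_perm_three (i := i) (j := j) (k := i + j + 1)
      hij (by omega) (by omega)
    refine hμ.integral_eq_of_act hσ ((hmeas 0).mul (hmeas 1)) fun x => ?_
    have h0' := MarkedPartition.isSingleton_act σ x.1 0
    have h1' := MarkedPartition.isSingleton_act σ x.1 1
    rw [h0] at h0'
    rw [h1] at h1'
    change ind ((x.1.act _).IsSingleton 0) * ind ((x.1.act _).IsSingleton 1) = _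
    rw [h0', h1']

end InvariantLaw

/-! ### No loss of mass: convergence of sums of powers of block proportions. -/

/-- Convergence of sums that are dominated by convergent sums. -/
theorem tendsto_tsum_of_le_of_tendsto_tsum {h b : ℕ → ℕ → ℝ} {h' g : ℕ → ℝ}
    (h0 : ∀ n i, 0 ≤ h n i) (hb : ∀ n i, h n i ≤ b n i) (hbs : ∀ n, Summable (b n))
    (hg0 : ∀ i, 0 ≤ g i) (hg : Summable g) (hlim : ∀ i, Tendsto (fun n => h n i) atTop (𝓝 (h' i)))
    (blim : ∀ i, Tendsto (fun n => b n i) atTop (𝓝 (g i)))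
    (hsum : Tendsto (fun n => ∑' i, b n i) atTop (𝓝 (∑' i, g i))) :
    Tendsto (fun n => ∑' i, h n i) atTop (𝓝 (∑' i, h' i)) := by
  have hb0 : ∀ n i, 0 ≤ b n i := fun n i => (h0 n i).trans (hb n i)
  have hh' : ∀ i, h' i ≤ g i := fun i => le_of_tendsto_of_tendsto' (hlim i) (blim i) fun n => hb n i
  have hhs : ∀ n, Summable (h n) := fun n => (hbs n).of_nonneg_of_le (h0 n) (hb n)
  -- This is Scheffé's argument: truncation at the summable limit `g` permits dominated convergence.
  have hmin : ∀ {f : ℕ → ℕ → ℝ} {f' : ℕ → ℝ}, (∀ n i, 0 ≤ f n i) → (∀ i, f' i ≤ g i) →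
      (∀ i, Tendsto (fun n => f n i) atTop (𝓝 (f' i))) →
      Tendsto (fun n => ∑' i, min (f n i) (g i)) atTop (𝓝 (∑' i, f' i)) := by
    intro f f' hf hf' hl
    refine tendsto_tsum_of_dominated_convergence hg (fun i => ?_) (.of_forall fun n i => ?_)
    · have := (hl i).min (tendsto_const_nhds (x := g i))
      rwa [min_eq_left (hf' i)] at this
    · rw [Real.norm_eq_abs, abs_of_nonneg (le_min (hf n i) (hg0 i))]
      exact min_le_right _ _
  have hsm : ∀ {f : ℕ → ℝ}, (∀ i, 0 ≤ f i) → Summable fun i => min (f i) (g i) := fun hf =>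
    hg.of_nonneg_of_le (fun i => le_min (hf i) (hg0 i)) fun i => min_le_right _ _
  have h1 := hmin h0 hh' hlim
  have h2 := hmin hb0 (fun _ => le_rfl) blim
  have h3 := hsum.sub h2
  rw [sub_self] at h3
  have h4 := h1.add h3
  rw [add_zero] at h4
  refine tendsto_of_tendsto_of_tendsto_of_le_of_le h1 h4 (fun n => ?_) fun n => ?_
  · exact (hsm (h0 n)).tsum_le_tsum (fun i => min_le_left _ _) (hhs n)
  -- The part of `h` cut off by the truncation is at most that of `b`, whose sum tends to zero by
  -- `h3`.
  · have : ∑' i, (h n i - min (h n i) (g i)) ≤ ∑' i, (b n i - min (b n i) (g i)) := by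
      refine ((hhs n).sub (hsm (h0 n))).tsum_le_tsum (fun i => ?_) ((hbs n).sub (hsm (hb0 n)))
      have := hb n i
      rcases le_total (h n i) (g i) with h5 | h5 <;> rcases le_total (b n i) (g i) with h6 | h6 <;>
        simp only [min_eq_left, min_eq_right, h5, h6] <;> linarith
    rw [(hhs n).tsum_sub (hsm (h0 n)), (hbs n).tsum_sub (hsm (hb0 n))] at this
    linarith

/-- The properties of a typical realization of an exchangeable marked partition. -/
structure NonDegPartition.Regular (x : NonDegPartition) : Prop where
  hasFreqs : x.1.HasAsymptoticFreqs
  tendsto_singletons : Tendsto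
    (fun n : ℕ => (∑ j ∈ Finset.range n, ind (x.1.IsSingleton j)) / (n : ℝ)) atTop
    (𝓝 (1 - ∑' i, x.1.firstFreq i))

namespace InvariantLaw

variable {μ : Measure NonDegPartition} [IsProbabilityMeasure μ]

theorem aemeasurable_tsum_firstFreq (hμ : InvariantLaw μ) :
    AEMeasurable (fun x : NonDegPartition => ∑' i, x.1.firstFreq i) μ := by
  refine aemeasurable_of_tendsto_metrizable_ae atTop
    (f := fun n (x : NonDegPartition) => ∑ i ∈ Finset.range n, x.1.firstFreq i) (fun n => ?_) ?_
  · exact (Finset.measurable_sum _ fun i _ =>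
      (MarkedPartition.measurable_firstFreq i).comp measurable_subtype_coe).aemeasurable
  · filter_upwards [hμ.ae_hasAsymptoticFreqs] with x hx
    exact (MarkedPartition.summable_firstFreq hx).hasSum.tendsto_sum_nat

theorem integrable_tsum_firstFreq (hμ : InvariantLaw μ) :
    Integrable (fun x : NonDegPartition => ∑' i, x.1.firstFreq i) μ := by
  refine .of_bound hμ.aemeasurable_tsum_firstFreq.aestronglyMeasurable 1 ?_
  filter_upwards [hμ.ae_hasAsymptoticFreqs] with x hx
  rw [Real.norm_eq_abs, abs_of_nonneg (tsum_nonneg (MarkedPartition.firstFreq_nonneg hx))]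
  exact (MarkedPartition.summable_firstFreq hx).tsum_le_of_sum_le
    (MarkedPartition.sum_firstFreq_le_one hx)

theorem measurable_freq (i : ℕ) : Measurable fun x : NonDegPartition => x.1.freq i :=
  (MarkedPartition.measurable_freq i).comp measurable_subtype_coe

/-- By invariance the left-hand side is the mean proportion of integers in blocks of frequency at
least `ε`, and this proportion tends to the sum of those frequencies. -/
theorem integral_freq_ge_le (hμ : InvariantLaw μ) {ε : ℝ} (hε : 0 < ε) :
    ∫ x, ind (ε ≤ x.1.freq 0) ∂μ ≤ ∫ x, ∑' i, x.1.firstFreq i ∂μ := by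
  have hmeas : ∀ i, Measurable fun x : NonDegPartition => ind (ε ≤ x.1.freq i) := fun i =>
    measurable_ind (measurableSet_le measurable_const (measurable_freq i))
  have heq : ∀ i, ∫ x, ind (ε ≤ x.1.freq i) ∂μ = ∫ x, ind (ε ≤ x.1.freq 0) ∂μ := by
    intro i
    refine hμ.integral_eq_of_act (finite_swap_ne 0 i) (hmeas 0) fun x => ?_
    have h := MarkedPartition.freq_act (finite_swap_ne 0 i) x.1 0
    rw [Equiv.swap_apply_left] at h
    change ind (ε ≤ (x.1.act _).freq 0) = _
    rw [h]
  let A : ℕ → NonDegPartition → ℝ := fun n x =>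
    (∑ j ∈ Finset.range n, ind (ε ≤ x.1.freq j)) / (n : ℝ)
  have hA : ∀ n, 0 < n → ∫ x, A n x ∂μ = ∫ x, ind (ε ≤ x.1.freq 0) ∂μ := by
    intro n hn
    simp only [A]
    rw [integral_div, integral_finsetSum _ fun j _ =>
      integrable_of_mem_Icc (hmeas j) fun x => ind_mem_Icc _, Finset.sum_congr rfl fun j _ => heq j]
    have : (n : ℝ) ≠ 0 := by positivity
    simp only [Finset.sum_const, Finset.card_range, nsmul_eq_mul]
    field_simp
  classical
  let U : NonDegPartition → ℝ := fun x => if hx : x.1.HasAsymptoticFreqs then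
    ∑ k ∈ (MarkedPartition.finite_freq_ge hx hε).toFinset, x.1.freq k else 0
  have hU : ∀ᵐ x ∂μ, Tendsto (fun n => A n x) atTop (𝓝 (U x)) := by
    filter_upwards [hμ.ae_hasAsymptoticFreqs] with x hx
    simp only [A, U, dif_pos hx, MarkedPartition.average_freq_ge_eq hx hε]
    exact tendsto_finsetSum _ fun k _ => hx.tendsto k
  have hlim := tendsto_integral_of_dominated_convergence (F := A) (fun _ => (1 : ℝ))
    (fun n => ((Finset.measurable_sum _ fun j _ => hmeas j).div_const _).aestronglyMeasurable)
    (integrable_const (μ := μ) 1) (fun n => .of_forall fun x => by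
      have := average_ind_mem_Icc (fun j => ε ≤ x.1.freq j) n
      rw [Real.norm_eq_abs, abs_of_nonneg this.1]
      exact this.2) hU
  have hlim' : Tendsto (fun n => ∫ x, A n x ∂μ) atTop (𝓝 (∫ x, ind (ε ≤ x.1.freq 0) ∂μ)) :=
    tendsto_const_nhds.congr' (by
      filter_upwards [eventually_gt_atTop 0] with n hn using (hA n hn).symm)
  rw [tendsto_nhds_unique hlim' hlim]
  refine integral_mono_of_nonneg ?_ hμ.integrable_tsum_firstFreq ?_
  · filter_upwards [hμ.ae_hasAsymptoticFreqs] with x hx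
    simp only [U, dif_pos hx]
    exact Finset.sum_nonneg fun k _ => MarkedPartition.freq_nonneg hx k
  · filter_upwards [hμ.ae_hasAsymptoticFreqs] with x hx
    simp only [U, dif_pos hx]
    exact MarkedPartition.sum_freq_ge_le_tsum hx hε

theorem integral_freq_pos_le (hμ : InvariantLaw μ) :
    ∫ x, ind (0 < x.1.freq 0) ∂μ ≤ ∫ x, ∑' i, x.1.firstFreq i ∂μ := by
  have hlim : Tendsto (fun n : ℕ => ∫ x, ind (1 / ((n : ℝ) + 1) ≤ x.1.freq 0) ∂μ) atTop
      (𝓝 (∫ x, ind (0 < x.1.freq 0) ∂μ)) := by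
    refine tendsto_integral_of_dominated_convergence (fun _ => (1 : ℝ)) (fun n => ?_)
      (integrable_const _) (fun n => .of_forall fun x => ?_) (.of_forall fun x => ?_)
    · exact (measurable_ind (measurableSet_le measurable_const
        (measurable_freq 0))).aestronglyMeasurable
    · rw [Real.norm_eq_abs, abs_of_nonneg (ind_nonneg _)]
      exact ind_le_one _
    · refine tendsto_const_nhds.congr' ?_
      by_cases h : 0 < x.1.freq 0
      · filter_upwards [(tendsto_one_div_add_atTop_nhds_zero_nat (𝕜 := ℝ)).eventually_lt_const h]
          with n hn
        rw [ind_of h, ind_of hn.le]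
      · refine .of_forall fun n => ?_
        have : (0 : ℝ) < 1 / ((n : ℝ) + 1) := by positivity
        rw [ind_of_not h]
        exact (ind_of_not fun h' => h (this.trans_le h')).symm
  exact le_of_tendsto' hlim fun n => hμ.integral_freq_ge_le (by positivity)

/-- Let `d` be the density of singletons. Almost surely `d` plus the sum of the frequencies is at
most `1`. Its mean is at least the probability that `0` is a singleton plus the probability that its
frequency is positive, hence at least `1` by `ae_isSingleton`. So equality holds almost surely. -/
theorem ae_regular (hμ : InvariantLaw μ) : ∀ᵐ x ∂μ, x.Regular := by
  have hmeas : ∀ i, Measurable fun x : NonDegPartition => ind (x.1.IsSingleton i) := fun i =>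
    (measurable_ind (MarkedPartition.measurableSet_isSingleton i)).comp measurable_subtype_coe
  have heq : ∀ i, ∫ x, ind (x.1.IsSingleton i) ∂μ = ∫ x, ind (x.1.IsSingleton 0) ∂μ := by
    intro i
    refine hμ.integral_eq_of_act (finite_swap_ne 0 i) (hmeas 0) fun x => ?_
    have h := MarkedPartition.isSingleton_act (Equiv.swap 0 i) x.1 0
    rw [Equiv.swap_apply_left] at h
    change ind ((x.1.act _).IsSingleton 0) = _
    rw [h]
  let A : ℕ → NonDegPartition → ℝ := fun n x =>
    (∑ j ∈ Finset.range n, ind (x.1.IsSingleton j)) / (n : ℝ)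
  have hAm : ∀ n, Measurable (A n) := fun n =>
    (Finset.measurable_sum _ fun j _ => hmeas j).div_const _
  let d : NonDegPartition → ℝ := fun x => limUnder atTop fun n => A n x
  have hdm : Measurable d :=
    (StronglyMeasurable.limUnder fun n => (hAm n).stronglyMeasurable).measurable
  have hd : ∀ᵐ x ∂μ, Tendsto (fun n => A n x) atTop (𝓝 (d x)) := by
    filter_upwards [hμ.ae_exists_tendsto_singletons] with x hx using tendsto_nhds_limUnder hx
  have hAI : ∀ n x, A n x ∈ Set.Icc (0 : ℝ) 1 := fun n x => average_ind_mem_Icc _ n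
  have hdI : ∀ᵐ x ∂μ, ‖d x‖ ≤ 1 := by
    filter_upwards [hd] with x hx
    rw [Real.norm_eq_abs, abs_of_nonneg (ge_of_tendsto' hx fun n => (hAI n x).1)]
    exact le_of_tendsto' hx fun n => (hAI n x).2
  have hdint : Integrable d μ := .of_bound hdm.aestronglyMeasurable 1 hdI
  have hEd : ∫ x, d x ∂μ = ∫ x, ind (x.1.IsSingleton 0) ∂μ := by
    have hlim := tendsto_integral_of_dominated_convergence (F := A) (fun _ => (1 : ℝ))
      (fun n => (hAm n).aestronglyMeasurable) (integrable_const (μ := μ) 1)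
      (fun n => .of_forall fun x => by
        rw [Real.norm_eq_abs, abs_of_nonneg (hAI n x).1]
        exact (hAI n x).2) hd
    refine tendsto_nhds_unique hlim (tendsto_const_nhds.congr' ?_)
    filter_upwards [eventually_gt_atTop 0] with n hn
    simp only [A]
    rw [integral_div, integral_finsetSum _ fun j _ =>
      integrable_of_mem_Icc (hmeas j) fun x => ind_mem_Icc _, Finset.sum_congr rfl fun j _ => heq j]
    have : (n : ℝ) ≠ 0 := by positivity
    simp only [Finset.sum_const, Finset.card_range, nsmul_eq_mul]
    field_simp
  have hpm : Measurable fun x : NonDegPartition => ind (0 < x.1.freq 0) :=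
    measurable_ind (measurableSet_lt measurable_const (measurable_freq 0))
  have hone : 1 ≤ ∫ x, ind (x.1.IsSingleton 0) ∂μ + ∫ x, ind (0 < x.1.freq 0) ∂μ := by
    rw [← integral_add (integrable_of_mem_Icc (hmeas 0) fun x => ind_mem_Icc _)
      (integrable_of_mem_Icc hpm fun x => ind_mem_Icc _)]
    have h1 : ∫ _x, (1 : ℝ) ∂μ = 1 := by simp
    rw [← h1]
    refine integral_mono_ae (integrable_const _)
      ((integrable_of_mem_Icc (hmeas 0) fun x => ind_mem_Icc _).add
      (integrable_of_mem_Icc hpm fun x => ind_mem_Icc _)) ?_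
    filter_upwards [hμ.ae_hasAsymptoticFreqs, hμ.ae_isSingleton] with x hx hs
    rcases (MarkedPartition.freq_nonneg hx 0).lt_or_eq with h | h
    · simp only [ind_of h]
      linarith [ind_nonneg (x.1.IsSingleton 0)]
    · simp only [ind_of (hs 0 h.symm)]
      linarith [ind_nonneg (0 < x.1.freq 0)]
  have hFint := hμ.integrable_tsum_firstFreq
  have hsumint : Integrable (fun x : NonDegPartition => d x + ∑' i, x.1.firstFreq i) μ :=
    hdint.add hFint
  have hle : 0 ≤ᵐ[μ] fun x : NonDegPartition => 1 - (d x + ∑' i, x.1.firstFreq i) := by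
    filter_upwards [hμ.ae_hasAsymptoticFreqs, hd] with x hx hdx
    exact sub_nonneg.2 (MarkedPartition.add_tsum_firstFreq_le_one hx hdx)
  have hzero : ∫ x, (1 - (d x + ∑' i, x.1.firstFreq i)) ∂μ = 0 := by
    refine le_antisymm ?_ (integral_nonneg_of_ae hle)
    rw [integral_sub (integrable_const _) hsumint, integral_add hdint hFint, hEd]
    have := hμ.integral_freq_pos_le
    simp only [integral_const, probReal_univ, smul_eq_mul, mul_one]
    linarith
  have hae := (integral_eq_zero_iff_of_nonneg_ae hle ((integrable_const _).sub hsumint)).1 hzero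
  filter_upwards [hae, hμ.ae_hasAsymptoticFreqs, hd] with x h1 hx hdx
  refine ⟨hx, ?_⟩
  have : 1 - (d x + ∑' i, x.1.firstFreq i) = 0 := h1
  have h2 : 1 - ∑' i, x.1.firstFreq i = d x := by linarith
  rw [h2]
  exact hdx

end InvariantLaw

namespace MarkedPartition

theorem firstRatio_le_one (x : MarkedPartition) (n i : ℕ) : x.firstRatio n i ≤ 1 :=
  mul_le_one₀ (ind_le_one _) (x.ratio_nonneg i n) (x.ratio_le_one i n)

theorem summable_firstRatio (x : MarkedPartition) (n : ℕ) : Summable (x.firstRatio n) :=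
  summable_of_ne_finset_zero (s := Finset.range n) fun _ hi =>
    firstRatio_eq_zero (not_lt.1 fun h => hi (Finset.mem_range.2 h))

theorem ind_mul_pow_le {b : ℝ} (hb0 : 0 ≤ b) (hb1 : b ≤ 1) (p : Prop) {m : ℕ} (hm : m ≠ 0) :
    ind p * b ^ m ≤ b :=
  (mul_le_of_le_one_left (pow_nonneg hb0 _) (ind_le_one _)).trans (pow_le_of_le_one hb0 hb1 hm)

theorem summable_ind_mul_firstRatio_pow (x : MarkedPartition) (n : ℕ) (p : ℕ → Prop) {m : ℕ}
    (hm : m ≠ 0) : Summable fun i => ind (p i) * x.firstRatio n i ^ m :=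
  (x.summable_firstRatio n).of_nonneg_of_le
    (fun i => mul_nonneg (ind_nonneg _) (pow_nonneg (x.firstRatio_nonneg n i) _))
    fun i => ind_mul_pow_le (x.firstRatio_nonneg n i) (x.firstRatio_le_one n i) _ hm

theorem firstFreq_le_one {x : MarkedPartition} (hx : x.HasAsymptoticFreqs) (i : ℕ) :
    x.firstFreq i ≤ 1 := by
  unfold firstFreq
  split_ifs
  exacts [freq_le_one hx i, zero_le_one]

theorem summable_ind_mul_firstFreq_pow {x : MarkedPartition} (hx : x.HasAsymptoticFreqs)
    (p : ℕ → Prop) {m : ℕ} (hm : m ≠ 0) : Summable fun i => ind (p i) * x.firstFreq i ^ m :=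
  (summable_firstFreq hx).of_nonneg_of_le
    (fun i => mul_nonneg (ind_nonneg _) (pow_nonneg (firstFreq_nonneg hx i) _))
    fun i => ind_mul_pow_le (firstFreq_nonneg hx i) (firstFreq_le_one hx i) _ hm

end MarkedPartition

/-- All terms are dominated by the block proportions, whose total mass converges to that of the
frequencies by regularity. This is essential for `m = 1`, where mass could otherwise escape to small
blocks. -/
theorem NonDegPartition.Regular.tendsto_tsum {x : NonDegPartition} (hx : x.Regular) (p : ℕ → Prop)
    {m : ℕ} (hm : m ≠ 0) :
    Tendsto (fun n => ∑' i, ind (p i) * x.1.firstRatio n i ^ m) atTop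
      (𝓝 (∑' i, ind (p i) * x.1.firstFreq i ^ m)) := by
  refine tendsto_tsum_of_le_of_tendsto_tsum (b := x.1.firstRatio)
    (fun n i => mul_nonneg (ind_nonneg _) (pow_nonneg (x.1.firstRatio_nonneg n i) _))
    (fun n i => MarkedPartition.ind_mul_pow_le (x.1.firstRatio_nonneg n i)
      (x.1.firstRatio_le_one n i) _ hm)
    x.1.summable_firstRatio (MarkedPartition.firstFreq_nonneg hx.hasFreqs)
    (MarkedPartition.summable_firstFreq hx.hasFreqs)
    (fun i => ((MarkedPartition.tendsto_firstRatio hx.hasFreqs i).pow m).const_mul _)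
    (MarkedPartition.tendsto_firstRatio hx.hasFreqs) ?_
  have h := hx.tendsto_singletons.const_sub 1
  rw [sub_sub_cancel] at h
  refine h.congr' ?_
  filter_upwards [eventually_gt_atTop 0] with n hn
  rw [tsum_eq_sum (s := Finset.range n) fun i hi =>
    MarkedPartition.firstRatio_eq_zero (not_lt.1 fun h => hi (Finset.mem_range.2 h))]
  linarith [x.1.singletons_add_sum_firstRatio hn]

theorem NonDegPartition.Regular.tendsto_tsum_ofReal {x : NonDegPartition} (hx : x.Regular)
    (p : ℕ → Prop) {m : ℕ} (hm : m ≠ 0) :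
    Tendsto (fun n => ∑' i, ENNReal.ofReal (ind (p i)) * ENNReal.ofReal (x.1.firstRatio n i) ^ m)
      atTop (𝓝 (∑' i, ENNReal.ofReal (ind (p i)) * ENNReal.ofReal (x.1.firstFreq i) ^ m)) := by
  have key : ∀ {b : ℕ → ℝ}, (∀ i, 0 ≤ b i) → Summable (fun i => ind (p i) * b i ^ m) →
      ∑' i, ENNReal.ofReal (ind (p i)) * ENNReal.ofReal (b i) ^ m =
        ENNReal.ofReal (∑' i, ind (p i) * b i ^ m) := by
    intro b hb hs
    rw [ENNReal.ofReal_tsum_of_nonneg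
      (fun i => mul_nonneg (ind_nonneg _) (pow_nonneg (hb i) _)) hs]
    refine tsum_congr fun i => ?_
    rw [ENNReal.ofReal_mul (ind_nonneg _), ENNReal.ofReal_pow (hb i)]
  rw [key (MarkedPartition.firstFreq_nonneg hx.hasFreqs)
    (MarkedPartition.summable_ind_mul_firstFreq_pow hx.hasFreqs p hm)]
  simp_rw [fun n => key (x.1.firstRatio_nonneg n) (x.1.summable_ind_mul_firstRatio_pow n p hm)]
  exact (ENNReal.continuous_ofReal.tendsto _).comp (hx.tendsto_tsum p hm)

/-! ### The product formula for independent points falling into disjoint boxes. -/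

/-- The event that, for each `a ∈ J`, the points `u i`, `i ∈ S a`, are all in the same box `B k`,
for some `k` such that `K a k`. -/
def boxEvent {A : Type*} (B : ℕ → Set A) (J : Finset ℕ) (S : ℕ → Finset ℕ) (K : ℕ → ℕ → Prop) :
    Set (ℕ → A) :=
  {u | ∀ a ∈ J, ∃ k, K a k ∧ ∀ i ∈ S a, u i ∈ B k}

section BoxEvent

variable {A : Type*} [MeasurableSpace A] {B : ℕ → Set A}

theorem measurableSet_rectangle {s : ℕ → Set A} (hs : ∀ i, MeasurableSet (s i)) (T : Finset ℕ) :
    MeasurableSet {u : ℕ → A | ∀ i ∈ T, u i ∈ s i} := by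
  simp only [Set.ofPred_forall]
  exact .iInter fun i => .iInter fun _ => measurable_pi_apply i (hs i)

theorem measurableSet_boxEvent (hB : ∀ k, MeasurableSet (B k)) (J : Finset ℕ) (S : ℕ → Finset ℕ)
    (K : ℕ → ℕ → Prop) : MeasurableSet (boxEvent B J S K) := by
  simp only [boxEvent, Set.ofPred_forall, Set.ofPred_exists, Set.ofPred_and]
  exact .iInter fun a => .iInter fun _ => .iUnion fun k => (MeasurableSet.const _).inter
    (.iInter fun i => .iInter fun _ => measurable_pi_apply i (hB k))

variable (α : Measure A) [IsProbabilityMeasure α]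

theorem infinitePi_rectangle {s : ℕ → Set A} (hs : ∀ i, MeasurableSet (s i)) (T : Finset ℕ) :
    (Measure.infinitePi fun _ : ℕ => α) {u | ∀ i ∈ T, u i ∈ s i} = ∏ i ∈ T, α (s i) := by
  rw [← Measure.infinitePi_pi (fun _ : ℕ => α) (s := T) (t := s) fun i _ => hs i]
  rfl

/-- The rectangle on `T` serves the induction on `J`: once a box `k` is chosen for the class `a`,
its constraint is a rectangle on `S a` and joins `T`. Different `k` give disjoint events because `S
a` is nonempty. -/
theorem infinitePi_rectangle_inter_boxEvent (hB : ∀ k, MeasurableSet (B k))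
    (hd : Pairwise fun k l => Disjoint (B k) (B l)) (S : ℕ → Finset ℕ) (K : ℕ → ℕ → Prop)
    (J : Finset ℕ) (hS : ∀ a ∈ J, (S a).Nonempty)
    (hdisj : ∀ a ∈ J, ∀ b ∈ J, a ≠ b → Disjoint (S a) (S b)) (T : Finset ℕ)
    (hT : ∀ a ∈ J, Disjoint T (S a)) {s : ℕ → Set A} (hs : ∀ i, MeasurableSet (s i)) :
    (Measure.infinitePi fun _ : ℕ => α) ({u | ∀ i ∈ T, u i ∈ s i} ∩ boxEvent B J S K) =
      (∏ i ∈ T, α (s i)) *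
        ∏ a ∈ J, ∑' k, ENNReal.ofReal (ind (K a k)) * α (B k) ^ (S a).card := by
  classical
  induction J using Finset.induction_on generalizing T s with
  | empty =>
    rw [Finset.prod_empty, mul_one, ← infinitePi_rectangle α hs T]
    congr 1
    ext u
    simp [boxEvent]
  | insert a J ha ih =>
    let s' : ℕ → ℕ → Set A := fun k i => if i ∈ S a then B k else s i
    have hs' : ∀ k i, MeasurableSet (s' k i) := by
      intro k i
      simp only [s']
      split_ifs
      exacts [hB k, hs i]
    have hTa : Disjoint T (S a) := hT a (Finset.mem_insert_self a J)
    let R : ℕ → Set (ℕ → A) := fun k =>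
      {u | K a k} ∩ ({u | ∀ i ∈ T ∪ S a, u i ∈ s' k i} ∩ boxEvent B J S K)
    have hset : {u : ℕ → A | ∀ i ∈ T, u i ∈ s i} ∩ boxEvent B (insert a J) S K = ⋃ k, R k := by
      ext u
      simp only [R, boxEvent, Set.mem_inter_iff, Set.mem_ofPred_eq, Set.mem_iUnion,
        Finset.mem_insert, forall_eq_or_imp, Finset.mem_union, s']
      constructor
      · rintro ⟨h1, ⟨k, hk, h2⟩, h3⟩
        refine ⟨k, hk, fun i hi => ?_, h3⟩
        split_ifs with h
        · exact h2 i h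
        · exact h1 i (hi.resolve_right h)
      · rintro ⟨k, hk, h1, h2⟩
        refine ⟨fun i hi => ?_, ⟨k, hk, fun i hi => ?_⟩, h2⟩
        · have := h1 i (Or.inl hi)
          rwa [if_neg (Finset.disjoint_left.1 hTa hi)] at this
        · have := h1 i (Or.inr hi)
          rwa [if_pos hi] at this
    have hRd : Pairwise fun k l => Disjoint (R k) (R l) := by
      intro k l hkl
      obtain ⟨i, hi⟩ := hS a (Finset.mem_insert_self a J)
      refine Set.disjoint_left.2 fun u hu hu' => ?_
      have h1 := hu.2.1 i (Finset.mem_union_right _ hi)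
      have h2 := hu'.2.1 i (Finset.mem_union_right _ hi)
      simp only [s', if_pos hi] at h1 h2
      exact Set.disjoint_left.1 (hd hkl) h1 h2
    have hRm : ∀ k, MeasurableSet (R k) := fun k => (MeasurableSet.const _).inter
      ((measurableSet_rectangle (hs' k) _).inter (measurableSet_boxEvent hB J S K))
    have hR : ∀ k, (Measure.infinitePi fun _ : ℕ => α) (R k) =
        (∏ i ∈ T, α (s i)) * ((ENNReal.ofReal (ind (K a k)) * α (B k) ^ (S a).card) *
          ∏ b ∈ J, ∑' k, ENNReal.ofReal (ind (K b k)) * α (B k) ^ (S b).card) := by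
      intro k
      by_cases hk : K a k
      · have : R k = {u | ∀ i ∈ T ∪ S a, u i ∈ s' k i} ∩ boxEvent B J S K := by
          simp [R, hk]
        rw [this, ih (fun b hb => hS b (Finset.mem_insert_of_mem hb))
          (fun b hb c hc => hdisj b (Finset.mem_insert_of_mem hb) c (Finset.mem_insert_of_mem hc))
          _ (fun b hb => Finset.disjoint_union_left.2
            ⟨hT b (Finset.mem_insert_of_mem hb), hdisj a (Finset.mem_insert_self a J) b
              (Finset.mem_insert_of_mem hb) fun h => ha (h ▸ hb)⟩) (hs' k),
          Finset.prod_union hTa, ind_of hk, ENNReal.ofReal_one, one_mul, mul_assoc]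
        congr 1
        · exact Finset.prod_congr rfl fun i hi => by
            simp only [s', if_neg (Finset.disjoint_left.1 hTa hi)]
        · congr 1
          rw [Finset.prod_congr rfl fun i hi => by
            simp only [s', if_pos hi]; rfl]
          exact Finset.prod_const _
      · have : R k = ∅ := by simp [R, hk]
        rw [this, measure_empty, ind_of_not hk]
        simp
    rw [hset, measure_iUnion hRd hRm]
    simp_rw [hR]
    rw [ENNReal.tsum_mul_left, ENNReal.tsum_mul_right, Finset.prod_insert ha]

theorem infinitePi_boxEvent (hB : ∀ k, MeasurableSet (B k))
    (hd : Pairwise fun k l => Disjoint (B k) (B l)) (S : ℕ → Finset ℕ) (K : ℕ → ℕ → Prop)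
    (J : Finset ℕ) (hS : ∀ a ∈ J, (S a).Nonempty)
    (hdisj : ∀ a ∈ J, ∀ b ∈ J, a ≠ b → Disjoint (S a) (S b)) :
    (Measure.infinitePi fun _ : ℕ => α) (boxEvent B J S K) =
      ∏ a ∈ J, ∑' k, ENNReal.ofReal (ind (K a k)) * α (B k) ^ (S a).card := by
  have := infinitePi_rectangle_inter_boxEvent α hB hd S K J hS hdisj ∅ (by simp)
    (s := fun _ => Set.univ) (by simp)
  simpa using this

end BoxEvent

/-! ### Test events as box events, for paintboxes and for samples. -/

section Cylinder

variable (n : ℕ) (E : Setoid ℕ) (C : ℕ → Set Mark)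

open Classical in
/-- The elements below `n` of the class of `a`. -/
noncomputable def cylinderClass (a : ℕ) : Finset ℕ := (Finset.range n).filter fun i => E i a

open Classical in
/-- The first elements of the classes on which the event `cylinderEvent E C` is a constraint. -/
noncomputable def activeClasses : Finset ℕ :=
  (Finset.range n).filter fun a =>
    (∀ b < a, ¬ E b a) ∧ ((∃ i ∈ cylinderClass n E a, i ≠ a) ∨ C a ≠ Set.univ)

/-- The mark `v` is allowed on the class of `a`. -/
def AllowedMark (v : Mark) (a : ℕ) : Prop := ∀ i ∈ cylinderClass n E a, v ∈ C i

variable {n E C}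

theorem mem_cylinderClass {i a : ℕ} : i ∈ cylinderClass n E a ↔ i < n ∧ E i a := by
  simp [cylinderClass]

theorem mem_activeClasses {a : ℕ} : a ∈ activeClasses n E C ↔ a < n ∧ (∀ b < a, ¬ E b a) ∧
    ((∃ i ∈ cylinderClass n E a, i ≠ a) ∨ C a ≠ Set.univ) := by
  simp [activeClasses]

theorem self_mem_cylinderClass {a : ℕ} (ha : a ∈ activeClasses n E C) :
    a ∈ cylinderClass n E a :=
  mem_cylinderClass.2 ⟨(mem_activeClasses.1 ha).1, E.refl' a⟩

theorem disjoint_cylinderClass {a b : ℕ} (ha : a ∈ activeClasses n E C)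
    (hb : b ∈ activeClasses n E C) (hab : a ≠ b) :
    Disjoint (cylinderClass n E a) (cylinderClass n E b) := by
  refine Finset.disjoint_left.2 fun i hi hi' => ?_
  have h : E a b := E.trans' (E.symm' (mem_cylinderClass.1 hi).2) (mem_cylinderClass.1 hi').2
  rcases lt_or_gt_of_ne hab with h' | h'
  · exact (mem_activeClasses.1 hb).2.1 a h' h
  · exact (mem_activeClasses.1 ha).2.1 b h' (E.symm' h)

/-- A cylinder event for a marked partition painted by points of a space with disjoint boxes. -/
theorem mem_cylinderEvent_iff (hC : AdmissibleCylinder n E C) {A : Type*} {B : ℕ → Set A}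
    (hd : Pairwise fun k l => Disjoint (B k) (B l)) {v : ℕ → Mark} {u : ℕ → A}
    {y : MarkedPartition}
    (hpart : ∀ i < n, ∀ j < n, y.part i j ↔ i = j ∨ ∃ k, u i ∈ B k ∧ u j ∈ B k)
    (hmark : ∀ i < n, ∀ k, u i ∈ B k → y.mark i = v k)
    (hmark0 : ∀ i < n, (∀ k, u i ∉ B k) → y.mark i = 0) :
    y ∈ cylinderEvent E C ↔ u ∈ boxEvent B (activeClasses n E C) (cylinderClass n E)
      (fun a k => AllowedMark n E C (v k) a) := by
  constructor
  · rintro ⟨hE, hm⟩ a ha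
    obtain ⟨han, -, hact⟩ := mem_activeClasses.1 ha
    have hk : ∃ k, u a ∈ B k := by
      rcases hact with ⟨i, hi, hia⟩ | hCa
      · obtain ⟨hin, hEi⟩ := mem_cylinderClass.1 hi
        obtain ⟨k, -, hk⟩ := ((hpart i hin a han).1 (hE hEi)).resolve_left hia
        exact ⟨k, hk⟩
      · by_contra h
        push Not at h
        -- A point in no box has mark `0`, so `C a` contains `0` and by admissibility imposes no
        -- constraint.
        have h0 := hm a
        rw [hmark0 a han h] at h0
        exact hCa (hC.zero_notMem a h0)
    obtain ⟨k, hk⟩ := hk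
    have hall : ∀ i ∈ cylinderClass n E a, u i ∈ B k := by
      intro i hi
      obtain ⟨hin, hEi⟩ := mem_cylinderClass.1 hi
      rcases (hpart i hin a han).1 (hE hEi) with rfl | ⟨l, hl, hl'⟩
      · exact hk
      · by_cases hkl : l = k
        · exact hkl ▸ hl
        · exact absurd hk (Set.disjoint_left.1 (hd hkl) hl')
    refine ⟨k, fun i hi => ?_, hall⟩
    rw [← hmark i (mem_cylinderClass.1 hi).1 k (hall i hi)]
    exact hm i
  · intro h
    have hrep : ∀ i < n, ∃ a ≤ i, (∀ b < a, ¬ E b a) ∧ i ∈ cylinderClass n E a := by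
      classical
      intro i hi
      have hex : ∃ a, E a i := ⟨i, E.refl' i⟩
      exact ⟨Nat.find hex, Nat.find_min' hex (E.refl' i),
        fun b hb hE => Nat.find_min hex hb (E.trans' hE (Nat.find_spec hex)),
        mem_cylinderClass.2 ⟨hi, E.symm' (Nat.find_spec hex)⟩⟩
    constructor
    · intro i j hij
      rcases hC.le hij with rfl | ⟨hi, hj⟩
      · exact y.part.refl' i
      · by_cases hne : i = j
        · exact hne ▸ y.part.refl' i
        obtain ⟨a, hai, hmin, hia⟩ := hrep i hi
        have hja : j ∈ cylinderClass n E a :=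
          mem_cylinderClass.2 ⟨hj, E.trans' (E.symm' hij) (mem_cylinderClass.1 hia).2⟩
        have ha : a ∈ activeClasses n E C := by
          refine mem_activeClasses.2 ⟨hai.trans_lt hi, hmin, Or.inl ?_⟩
          by_cases h' : i = a
          · exact ⟨j, hja, fun h'' => hne (h'.trans h''.symm)⟩
          · exact ⟨i, hia, h'⟩
        obtain ⟨k, -, hk⟩ := h a ha
        exact (hpart i hi j hj).2 (Or.inr ⟨k, hk i hia, hk j hja⟩)
    · intro i
      by_cases hCi : C i = Set.univ
      · rw [hCi]; trivial
      have hi : i < n := by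
        by_contra h'
        exact hCi (hC.eq_univ i (not_lt.1 h'))
      obtain ⟨a, hai, hmin, hia⟩ := hrep i hi
      have ha : a ∈ activeClasses n E C := by
        refine mem_activeClasses.2 ⟨hai.trans_lt hi, hmin, ?_⟩
        by_cases h' : i = a
        · exact Or.inr (h' ▸ hCi)
        · exact Or.inl ⟨i, hia, h'⟩
      obtain ⟨k, hk, hk'⟩ := h a ha
      rw [hmark i hi k (hk' i hia)]
      exact hk i hia

end Cylinder

namespace RankedSeq

theorem paintboxLaw_cylinderEvent (z : RankedSeq) {n : ℕ} {E : Setoid ℕ} {C : ℕ → Set Mark}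
    (hC : AdmissibleCylinder n E C) :
    z.paintboxLaw (Subtype.val ⁻¹' cylinderEvent E C) = ∏ a ∈ activeClasses n E C,
      ∑' k, ENNReal.ofReal (ind (AllowedMark n E C (z.v k) a)) *
        ENNReal.ofReal (z.s k) ^ (cylinderClass n E a).card := by
  have hd : Pairwise fun k l => Disjoint (z.boxSet k) (z.boxSet l) := fun k l hkl =>
    Set.disjoint_left.2 fun u hu hu' => hkl (z.box_unique hu hu')
  have hset : z.paint ⁻¹' cylinderEvent E C = boxEvent z.boxSet (activeClasses n E C)
      (cylinderClass n E) (fun a k => AllowedMark n E C (z.v k) a) := by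
    ext u
    exact mem_cylinderEvent_iff hC hd (fun i _ j _ => Iff.rfl)
      (fun i _ k hk => z.paintMark_of_mem hk) fun i _ h => dif_neg fun ⟨k, hk⟩ => h k hk
  rw [paintboxLaw_preimage_val z (measurableSet_cylinderEvent hC), hset,
    infinitePi_boxEvent _ z.measurableSet_boxSet hd _ _ _
      (fun a ha => ⟨a, self_mem_cylinderClass ha⟩) fun a ha b hb => disjoint_cylinderClass ha hb]
  simp_rw [volume_boxSet]

end RankedSeq

namespace MarkedPartition

/-- As `m ≠ 0`, only positive frequencies contribute, and the ranking matches those bijectively. -/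
theorem IsRanking.tsum_eq {x : MarkedPartition} (hx : x.HasAsymptoticFreqs) {z : RankedSeq}
    (hz : x.IsRanking z) (p : Mark → Prop) {m : ℕ} (hm : m ≠ 0) :
    ∑' k, ENNReal.ofReal (ind (p (z.v k))) * ENNReal.ofReal (z.s k) ^ m =
      ∑' i, ENNReal.ofReal (ind (p (x.mark i))) * ENNReal.ofReal (x.firstFreq i) ^ m := by
  obtain ⟨g, hg⟩ := (isRanking_iff hx).1 hz
  let f : ℕ → ENNReal := fun k => ENNReal.ofReal (ind (p (z.v k))) * ENNReal.ofReal (z.s k) ^ m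
  let f' : ℕ → ENNReal := fun i =>
    ENNReal.ofReal (ind (p (x.mark i))) * ENNReal.ofReal (x.firstFreq i) ^ m
  have h1 : ∑' k : {k : ℕ // 0 < z.s k}, f k = ∑' k, f k := by
    refine tsum_subtype_eq_of_support_subset (f := f) (s := {k | 0 < z.s k}) fun k hk => ?_
    by_contra h
    refine hk ?_
    simp only [Set.mem_ofPred_eq, not_lt] at h
    simp only [f, ENNReal.ofReal_of_nonpos h, zero_pow hm, mul_zero]
  have h2 : ∑' i : {i : ℕ // x.IsFirst i ∧ 0 < x.freq i}, f' i = ∑' i, f' i := by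
    refine tsum_subtype_eq_of_support_subset (f := f') (s := {i | x.IsFirst i ∧ 0 < x.freq i})
      fun i hi => ?_
    by_contra h
    refine hi ?_
    have : x.firstFreq i ≤ 0 := by
      unfold firstFreq
      split_ifs with hf
      · exact not_lt.1 fun h' => h ⟨hf, h'⟩
      · exact le_rfl
    simp only [f', ENNReal.ofReal_of_nonpos this, zero_pow hm, mul_zero]
  change ∑' k, f k = ∑' i, f' i
  rw [← h1, ← h2, ← Equiv.tsum_eq g]
  refine tsum_congr fun k => ?_
  simp only [f, f']
  rw [(hg k).2, firstFreq, if_pos (g k).2.1, (hg k).1]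

/-- The blocks with several elements, indexed by their first elements. -/
def firstBlock (x : MarkedPartition) (k : ℕ) : Set ℕ :=
  {j | x.part j k ∧ x.IsFirst k ∧ ¬ x.IsSingleton k}

theorem disjoint_firstBlock (x : MarkedPartition) :
    Pairwise fun k l => Disjoint (x.firstBlock k) (x.firstBlock l) := fun _ _ hkl =>
  Set.disjoint_left.2 fun _ hj hj' =>
    Set.disjoint_left.1 (disjoint_block hj.2.1 hj'.2.1 hkl) hj.1 hj'.1

/-- This puts an arbitrary partition in the form of a painted one: the blocks with several elements
are the boxes, and the singletons play the role of the points outside all intervals. -/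
theorem part_iff_firstBlock {x : MarkedPartition} {i j : ℕ} :
    x.part i j ↔ i = j ∨ ∃ k, i ∈ x.firstBlock k ∧ j ∈ x.firstBlock k := by
  constructor
  · intro h
    by_cases hij : i = j
    · exact Or.inl hij
    · obtain ⟨k, hk, hkj⟩ := x.exists_isFirst j
      have hjk := x.part.symm' hkj
      have hik := x.part.trans' h hjk
      have hks : ¬ x.IsSingleton k := fun hs => hij ((hs i hik).trans (hs j hjk).symm)
      exact Or.inr ⟨k, ⟨hik, hk, hks⟩, hjk, hk, hks⟩
  · rintro (rfl | ⟨k, hi, hj⟩)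
    · exact x.part.refl' i
    · exact x.part.trans' hi.1 (x.part.symm' hj.1)

end MarkedPartition

/-- Non-degeneracy enters the sampling argument here: singletons are finite blocks, so they carry
the mark of the points outside the boxes. -/
theorem NonDegPartition.mark_eq_zero (x : NonDegPartition) {i : ℕ}
    (h : ∀ k, i ∉ x.1.firstBlock k) : x.1.mark i = 0 := by
  refine x.2 i ((Set.finite_singleton i).subset fun j hj => ?_)
  rcases MarkedPartition.part_iff_firstBlock.1 hj with rfl | ⟨k, hk, -⟩
  · rfl
  · exact absurd hk (h k)

/-- Sampling the integers along an injective sequence. -/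
theorem NonDegPartition.act_mem_cylinderEvent_iff (x : NonDegPartition) {n : ℕ} {E : Setoid ℕ}
    {C : ℕ → Set Mark} (hC : AdmissibleCylinder n E C) {u : ℕ → ℕ} {σ : Equiv.Perm ℕ}
    (hσ : ∀ k < n, σ k = u k) :
    (x.act σ).1 ∈ cylinderEvent E C ↔ u ∈ boxEvent x.1.firstBlock (activeClasses n E C)
      (cylinderClass n E) (fun a k => AllowedMark n E C (x.1.mark k) a) := by
  refine mem_cylinderEvent_iff hC x.1.disjoint_firstBlock ?_ ?_ ?_
  · intro i hi j hj
    change x.1.part (σ i) (σ j) ↔ _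
    rw [MarkedPartition.part_iff_firstBlock, σ.injective.eq_iff, hσ i hi, hσ j hj]
  · intro i hi k hk
    change x.1.mark (σ i) = _
    rw [hσ i hi]
    exact MarkedPartition.mark_congr hk.1
  · intro i hi h
    change x.1.mark (σ i) = _
    rw [hσ i hi]
    exact x.mark_eq_zero h

/-! ### Uniform sampling of integers and collisions. -/

/-- The uniform law on the integers `0, …, N`. -/
noncomputable def uniformUpTo (N : ℕ) : Measure ℕ :=
  ∑ k ∈ Finset.range (N + 1), ((N + 1 : ℕ) : ENNReal)⁻¹ • Measure.dirac k

theorem uniformUpTo_apply (N : ℕ) (B : Set ℕ) : uniformUpTo N B =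
    ENNReal.ofReal ((∑ j ∈ Finset.range (N + 1), ind (j ∈ B)) / ((N + 1 : ℕ) : ℝ)) := by
  classical
  rw [uniformUpTo, Measure.finsetSum_apply, Finset.sum_div,
    ENNReal.ofReal_sum_of_nonneg fun j _ => div_nonneg (ind_nonneg _) (by positivity)]
  refine Finset.sum_congr rfl fun j _ => ?_
  rw [Measure.smul_apply, Measure.dirac_apply' _ .of_discrete, smul_eq_mul, mul_comm,
    ← div_eq_mul_inv, ENNReal.ofReal_div_of_pos (by positivity), ENNReal.ofReal_natCast]
  congr 1
  by_cases h : j ∈ B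
  · rw [Set.indicator_of_mem h, ind_of h, ENNReal.ofReal_one, Pi.one_apply]
  · rw [Set.indicator_of_notMem h, ind_of_not h, ENNReal.ofReal_zero]

instance (N : ℕ) : IsProbabilityMeasure (uniformUpTo N) := by
  refine ⟨?_⟩
  have h : ((N + 1 : ℕ) : ℝ) ≠ 0 := by positivity
  rw [uniformUpTo_apply, Finset.sum_congr rfl fun j _ => ind_of (Set.mem_univ j)]
  rw [Finset.sum_const, Finset.card_range, nsmul_eq_mul, mul_one, div_self h, ENNReal.ofReal_one]

theorem uniformUpTo_singleton_le (N k : ℕ) : uniformUpTo N {k} ≤ ((N + 1 : ℕ) : ENNReal)⁻¹ := by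
  classical
  have hle : ∑ j ∈ Finset.range (N + 1), ind (j ∈ ({k} : Set ℕ)) ≤ 1 := by
    have : ∀ j ∈ Finset.range (N + 1), ind (j ∈ ({k} : Set ℕ)) = if k = j then 1 else 0 := by
      intro j _
      split_ifs with h
      · exact ind_of h.symm
      · exact ind_of_not fun h' => h h'.symm
    rw [Finset.sum_congr rfl this, Finset.sum_ite_eq]
    split_ifs <;> norm_num
  have hN : (0 : ℝ) < ((N + 1 : ℕ) : ℝ) := by positivity
  rw [uniformUpTo_apply, ENNReal.ofReal_div_of_pos hN, ENNReal.ofReal_natCast, div_eq_mul_inv]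
  exact mul_le_of_le_one_left (zero_le) (ENNReal.ofReal_le_one.2 hle)

theorem uniformUpTo_firstBlock (x : MarkedPartition) (N k : ℕ) :
    uniformUpTo N (x.firstBlock k) = ENNReal.ofReal (x.firstRatio (N + 1) k) := by
  rw [uniformUpTo_apply, MarkedPartition.firstRatio, MarkedPartition.ratio_eq, mul_div_assoc',
    Finset.mul_sum]
  congr 2
  refine Finset.sum_congr rfl fun j _ => ?_
  by_cases hk : x.IsFirst k ∧ ¬ x.IsSingleton k
  · rw [ind_of hk, one_mul]
    congr 1
    exact propext (and_iff_left hk)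
  · rw [ind_of_not hk, zero_mul]
    exact ind_of_not fun h => hk h.2

/-- The law of a sample of integers that are uniform on `0, …, N`. -/
noncomputable def sampleLaw (N : ℕ) : Measure (ℕ → ℕ) :=
  Measure.infinitePi fun _ : ℕ => uniformUpTo N

instance (N : ℕ) : IsProbabilityMeasure (sampleLaw N) := by
  unfold sampleLaw; infer_instance

theorem measurableSet_collision (i j : ℕ) : MeasurableSet {u : ℕ → ℕ | u i = u j} :=
  measurableSet_eq_fun (measurable_pi_apply i) (measurable_pi_apply j)

/-- The probability is at most the sum of the squared masses, hence at most the largest mass. -/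
theorem sampleLaw_collision_le (N : ℕ) {i j : ℕ} (hij : i ≠ j) :
    sampleLaw N {u | u i = u j} ≤ ((N + 1 : ℕ) : ENNReal)⁻¹ := by
  have hset : {u : ℕ → ℕ | u i = u j} =
      ⋃ k, {u | ∀ l ∈ ({i, j} : Finset ℕ), u l ∈ ({k} : Set ℕ)} := by
    ext u
    simp only [Set.mem_ofPred_eq, Set.mem_iUnion, Finset.mem_insert, Finset.mem_singleton,
      forall_eq_or_imp, forall_eq, Set.mem_singleton_iff]
    exact ⟨fun h => ⟨u j, h, rfl⟩, fun ⟨k, h1, h2⟩ => h1.trans h2.symm⟩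
  rw [hset]
  refine (measure_iUnion_le _).trans ?_
  calc ∑' k, sampleLaw N {u | ∀ l ∈ ({i, j} : Finset ℕ), u l ∈ ({k} : Set ℕ)}
      = ∑' k, uniformUpTo N {k} * uniformUpTo N {k} := by
        refine tsum_congr fun k => ?_
        rw [sampleLaw, infinitePi_rectangle (uniformUpTo N) (s := fun _ => {k})
          (fun _ => measurableSet_singleton k), Finset.prod_pair hij]
    _ ≤ ∑' k, ((N + 1 : ℕ) : ENNReal)⁻¹ * uniformUpTo N {k} :=
        ENNReal.tsum_le_tsum fun k => mul_le_mul_left (uniformUpTo_singleton_le N k) _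
    _ = ((N + 1 : ℕ) : ENNReal)⁻¹ := by
        rw [ENNReal.tsum_mul_left, ← measure_iUnion (fun k l hkl => by
          simpa using hkl) fun k => measurableSet_singleton k]
        have : ⋃ k : ℕ, ({k} : Set ℕ) = Set.univ := by ext; simp
        rw [this, measure_univ, mul_one]

/-- The event that a sample is not injective on `{i | i < n}`. -/
def collisionEvent (n : ℕ) : Set (ℕ → ℕ) :=
  ⋃ p ∈ (Finset.range n ×ˢ Finset.range n).filter fun p => p.1 ≠ p.2, {u | u p.1 = u p.2}

theorem measurableSet_collisionEvent (n : ℕ) : MeasurableSet (collisionEvent n) :=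
  Finset.measurableSet_biUnion _ fun p _ => measurableSet_collision p.1 p.2

theorem injOn_of_notMem_collisionEvent {n : ℕ} {u : ℕ → ℕ} (hu : u ∉ collisionEvent n) :
    Set.InjOn u (Set.Iio n) := by
  intro i hi j hj hij
  by_contra hne
  refine hu (Set.mem_biUnion (x := (i, j)) ?_ hij)
  simp only [Finset.coe_filter, Finset.mem_product, Finset.mem_range, Set.mem_ofPred_eq]
  exact ⟨⟨hi, hj⟩, hne⟩

theorem tendsto_sampleLaw_collisionEvent (n : ℕ) :
    Tendsto (fun N => sampleLaw N (collisionEvent n)) atTop (𝓝 0) := by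
  have hlim : Tendsto (fun N : ℕ => ((n * n : ℕ) : ENNReal) * ((N + 1 : ℕ) : ENNReal)⁻¹) atTop
      (𝓝 (((n * n : ℕ) : ENNReal) * 0)) :=
    ENNReal.Tendsto.const_mul ((tendsto_add_atTop_iff_nat 1).2
      ENNReal.tendsto_inv_nat_nhds_zero) (Or.inr (ENNReal.natCast_ne_top _))
  rw [mul_zero] at hlim
  refine tendsto_of_tendsto_of_tendsto_of_le_of_le tendsto_const_nhds hlim (fun N => zero_le)
    fun N => ?_
  refine (measure_biUnion_finset_le _ _).trans ?_
  refine (Finset.sum_le_card_nsmul _ _ _ fun p hp =>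
    sampleLaw_collision_le N (Finset.mem_filter.1 hp).2).trans ?_
  rw [nsmul_eq_mul]
  refine mul_le_mul_left (Nat.cast_le.2 ?_) _
  refine (Finset.card_filter_le _ _).trans ?_
  simp

/-- The event that a sample of a marked partition is in the event `cylinderEvent E C`, up to the
collisions of the sample. -/
def sampleEvent (n : ℕ) (E : Setoid ℕ) (C : ℕ → Set Mark) : Set (NonDegPartition × (ℕ → ℕ)) :=
  {p | p.2 ∈ boxEvent p.1.1.firstBlock (activeClasses n E C) (cylinderClass n E)
    (fun a k => AllowedMark n E C (p.1.1.mark k) a)}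

theorem measurableSet_sampleEvent {n : ℕ} {E : Setoid ℕ} {C : ℕ → Set Mark}
    (hC : AdmissibleCylinder n E C) : MeasurableSet (sampleEvent n E C) := by
  have hfb : ∀ i k, MeasurableSet {p : NonDegPartition × (ℕ → ℕ) | p.2 i ∈ p.1.1.firstBlock k} := by
    intro i k
    have : {p : NonDegPartition × (ℕ → ℕ) | p.2 i ∈ p.1.1.firstBlock k} =
        ⋃ j, {p | j ∈ p.1.1.firstBlock k} ∩ {p | p.2 i = j} := by
      ext p
      simp only [Set.mem_ofPred_eq, Set.mem_iUnion, Set.mem_inter_iff]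
      exact ⟨fun h => ⟨_, h, rfl⟩, fun ⟨j, h, hj⟩ => hj ▸ h⟩
    rw [this]
    refine .iUnion fun j => .inter ?_ ?_
    · have : MeasurableSet {x : MarkedPartition | j ∈ x.firstBlock k} :=
        (MarkedPartition.measurableSet_part j k).inter
          ((MarkedPartition.measurableSet_isFirst k).inter
            (MarkedPartition.measurableSet_isSingleton k).compl)
      exact (measurable_subtype_coe.comp measurable_fst) this
    · exact measurableSet_eq_fun ((measurable_pi_apply i).comp measurable_snd) measurable_const
  have hmark : ∀ a k, MeasurableSet
      {p : NonDegPartition × (ℕ → ℕ) | AllowedMark n E C (p.1.1.mark k) a} := by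
    intro a k
    simp only [AllowedMark, Set.ofPred_forall]
    exact .iInter fun i => .iInter fun _ =>
      ((NonDegPartition.measurable_mark k).comp measurable_fst) (hC.measurableSet i)
  have : sampleEvent n E C = ⋂ a, ⋂ (_ : a ∈ activeClasses n E C), ⋃ k,
      {p | AllowedMark n E C (p.1.1.mark k) a} ∩
        ⋂ i, ⋂ (_ : i ∈ cylinderClass n E a), {p | p.2 i ∈ p.1.1.firstBlock k} := by
    ext p
    simp [sampleEvent, boxEvent]
  rw [this]
  exact .iInter fun a => .iInter fun _ => .iUnion fun k => (hmark a k).inter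
    (.iInter fun i => .iInter fun _ => hfb i k)

/-- This has the shape of `paintboxLaw_cylinderEvent`, with empirical proportions in place of the
lengths of the intervals. -/
theorem sampleLaw_sampleEvent (x : NonDegPartition) (N n : ℕ) (E : Setoid ℕ) (C : ℕ → Set Mark) :
    sampleLaw N (Prod.mk x ⁻¹' sampleEvent n E C) = ∏ a ∈ activeClasses n E C,
      ∑' k, ENNReal.ofReal (ind (AllowedMark n E C (x.1.mark k) a)) *
        ENNReal.ofReal (x.1.firstRatio (N + 1) k) ^ (cylinderClass n E a).card := by
  refine (infinitePi_boxEvent (uniformUpTo N) (fun _ => .of_discrete) x.1.disjoint_firstBlock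
    (cylinderClass n E) (fun a k => AllowedMark n E C (x.1.mark k) a) (activeClasses n E C)
      (fun a ha => ⟨a, self_mem_cylinderClass ha⟩)
      fun a ha b hb => disjoint_cylinderClass ha hb).trans ?_
  simp_rw [uniformUpTo_firstBlock]

theorem NonDegPartition.Regular.tendsto_sampleLaw {x : NonDegPartition} (hx : x.Regular) {n : ℕ}
    {E : Setoid ℕ} {C : ℕ → Set Mark} (hC : AdmissibleCylinder n E C) :
    Tendsto (fun N => sampleLaw N (Prod.mk x ⁻¹' sampleEvent n E C)) atTop
      (𝓝 (x.1.ranked.paintboxLaw (Subtype.val ⁻¹' cylinderEvent E C))) := by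
  have hcard : ∀ a ∈ activeClasses n E C, (cylinderClass n E a).card ≠ 0 := fun a ha =>
    Finset.card_ne_zero_of_mem (self_mem_cylinderClass ha)
  have hlim : ∀ a ∈ activeClasses n E C, Tendsto (fun N => ∑' k,
      ENNReal.ofReal (ind (AllowedMark n E C (x.1.mark k) a)) *
        ENNReal.ofReal (x.1.firstRatio (N + 1) k) ^ (cylinderClass n E a).card) atTop
      (𝓝 (∑' k, ENNReal.ofReal (ind (AllowedMark n E C (x.1.ranked.v k) a)) *
        ENNReal.ofReal (x.1.ranked.s k) ^ (cylinderClass n E a).card)) := by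
    intro a ha
    rw [(MarkedPartition.isRanking_ranked hx.hasFreqs).tsum_eq hx.hasFreqs
      (fun v => AllowedMark n E C v a) (hcard a ha)]
    exact (tendsto_add_atTop_iff_nat 1).2
      (hx.tendsto_tsum_ofReal (fun k => AllowedMark n E C (x.1.mark k) a) (hcard a ha))
  simp_rw [sampleLaw_sampleEvent]
  rw [RankedSeq.paintboxLaw_cylinderEvent _ hC]
  refine ENNReal.tendsto_finsetProd_of_ne_top _ hlim fun a ha => ?_
  -- Limits of products in `ENNReal` need finite factors; here each is at most the sum of the
  -- frequencies.
  refine ne_top_of_le_ne_top x.1.ranked.2.2.2.1.tsum_ofReal_ne_top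
    (ENNReal.tsum_le_tsum fun k => ?_)
  refine (mul_le_of_le_one_left zero_le (ENNReal.ofReal_le_one.2 (ind_le_one _))).trans ?_
  exact pow_le_of_le_one zero_le (ENNReal.ofReal_le_one.2 (x.1.ranked.2.1 k).2) (hcard a ha)

/-! ### The mixture identity. -/

namespace InvariantLaw

variable {μ : Measure NonDegPartition}

/-- Only the first `n` draws matter, and they agree with a permutation of finite support, under
which `μ` is invariant. -/
theorem measure_sampleEvent_of_injOn (hμ : InvariantLaw μ) {n : ℕ} {E : Setoid ℕ}
    {C : ℕ → Set Mark} (hC : AdmissibleCylinder n E C) {u : ℕ → ℕ} (hu : Set.InjOn u (Set.Iio n)) :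
    μ ((fun x => (x, u)) ⁻¹' sampleEvent n E C) = μ (Subtype.val ⁻¹' cylinderEvent E C) := by
  obtain ⟨σ, hσ, h⟩ := exists_perm_extending u n hu
  conv_rhs => rw [← hμ σ hσ]
  rw [Measure.map_apply (NonDegPartition.measurable_act σ)
    (measurable_subtype_coe (measurableSet_cylinderEvent hC))]
  congr 1
  ext x
  exact (x.act_mem_cylinderEvent_iff hC h).symm

variable [IsProbabilityMeasure μ]

/-- The joint probability of the sample event is computed in two orders. With `x` fixed, it tends to
the paintbox probability; with `u` fixed and without collisions, it is already the probability under
`μ`. -/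
theorem lintegral_paintboxLaw_ranked (hμ : InvariantLaw μ) {n : ℕ} {E : Setoid ℕ}
    {C : ℕ → Set Mark} (hC : AdmissibleCylinder n E C) :
    ∫⁻ x, x.1.ranked.paintboxLaw (Subtype.val ⁻¹' cylinderEvent E C) ∂μ =
      μ (Subtype.val ⁻¹' cylinderEvent E C) := by
  set D : Set NonDegPartition := Subtype.val ⁻¹' cylinderEvent E C
  have hW := measurableSet_sampleEvent hC
  have hlim : Tendsto (fun N => ∫⁻ x, sampleLaw N (Prod.mk x ⁻¹' sampleEvent n E C) ∂μ) atTop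
      (𝓝 (∫⁻ x, x.1.ranked.paintboxLaw D ∂μ)) := by
    refine tendsto_lintegral_of_dominated_convergence (fun _ => 1)
      (fun N => measurable_measure_prodMk_left hW) (fun N => .of_forall fun x => prob_le_one)
      (by simp) ?_
    filter_upwards [hμ.ae_regular] with x hx using hx.tendsto_sampleLaw hC
  have hswap : ∀ N, ∫⁻ x, sampleLaw N (Prod.mk x ⁻¹' sampleEvent n E C) ∂μ =
      ∫⁻ u, μ ((fun x => (x, u)) ⁻¹' sampleEvent n E C) ∂(sampleLaw N) := by
    intro N
    rw [← Measure.prod_apply hW, Measure.prod_apply_symm hW]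
  have hind : ∀ N, ∫⁻ u, (collisionEvent n).indicator 1 u ∂(sampleLaw N) =
      sampleLaw N (collisionEvent n) := fun N =>
    lintegral_indicator_one (measurableSet_collisionEvent n)
  have hmi : Measurable ((collisionEvent n).indicator (1 : (ℕ → ℕ) → ENNReal)) :=
    measurable_one.indicator (measurableSet_collisionEvent n)
  -- Two probabilities differ by at most `1`, so the indicator of a collision bounds the error in
  -- both directions.
  have hpt : ∀ u, μ ((fun x => (x, u)) ⁻¹' sampleEvent n E C) ≤
      μ D + (collisionEvent n).indicator 1 u ∧
      μ D ≤ μ ((fun x => (x, u)) ⁻¹' sampleEvent n E C) + (collisionEvent n).indicator 1 u := by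
    intro u
    by_cases hu : u ∈ collisionEvent n
    · rw [Set.indicator_of_mem hu]
      exact ⟨prob_le_one.trans le_add_self, prob_le_one.trans le_add_self⟩
    · rw [hμ.measure_sampleEvent_of_injOn hC (injOn_of_notMem_collisionEvent hu)]
      exact ⟨le_self_add, le_self_add⟩
  have hcol := tendsto_sampleLaw_collisionEvent n
  refine le_antisymm ?_ ?_
  · have h1 : Tendsto (fun N => μ D + sampleLaw N (collisionEvent n)) atTop (𝓝 (μ D + 0)) :=
      tendsto_const_nhds.add hcol
    rw [add_zero] at h1
    refine le_of_tendsto_of_tendsto' hlim h1 fun N => ?_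
    rw [hswap]
    refine (lintegral_mono fun u => (hpt u).1).trans (le_of_eq ?_)
    rw [lintegral_add_right _ hmi, hind, lintegral_const, measure_univ, mul_one]
  · have h1 := hlim.add hcol
    rw [add_zero] at h1
    refine le_of_tendsto_of_tendsto' tendsto_const_nhds h1 fun N => ?_
    rw [hswap, ← hind N, ← lintegral_add_right _ hmi]
    refine le_trans (le_of_eq ?_) (lintegral_mono fun u => (hpt u).2)
    rw [lintegral_const, measure_univ, mul_one]

theorem measurable_ranked : Measurable fun x : NonDegPartition => x.1.ranked :=
  MarkedPartition.measurable_ranked.comp measurable_subtype_coe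

/-- An exchangeable law is the mixture of paintbox laws directed by the law of its ranked
sequence. -/
theorem eq_bind_paintboxLaw (hμ : InvariantLaw μ) :
    μ = (μ.map fun x : NonDegPartition => x.1.ranked).bind RankedSeq.paintboxLaw := by
  have hr : Measurable fun x : NonDegPartition => x.1.ranked := measurable_ranked
  have hb : ∀ {D : Set NonDegPartition}, MeasurableSet D →
      ((μ.map fun x : NonDegPartition => x.1.ranked).bind RankedSeq.paintboxLaw) D =
        ∫⁻ x, x.1.ranked.paintboxLaw D ∂μ := by
    intro D hD
    rw [Measure.bind_apply hD RankedSeq.measurable_paintboxLaw.aemeasurable]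
    exact lintegral_map ((Measure.measurable_coe hD).comp RankedSeq.measurable_paintboxLaw) hr
  refine ext_of_generate_finite cylinderEvents measurableSpace_eq_generateFrom_cylinderEvents
    isPiSystem_cylinderEvents ?_ ?_
  · rintro _ ⟨n, E, C, hC, rfl⟩
    rw [hb (measurable_subtype_coe (measurableSet_cylinderEvent hC)),
      hμ.lintegral_paintboxLaw_ranked hC]
  · rw [hb .univ]
    simp

end InvariantLaw

theorem mainTheorem4 {Ω : Type*} [MeasurableSpace Ω] (P : Measure Ω) [IsProbabilityMeasure P]
    (X : Ω → NonDegPartition) (hX : Measurable X) (hexch : Exchangeable P X) :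
    -- the family of paintbox laws is measurable, so that mixtures are defined
    Measurable RankedSeq.paintboxLaw ∧
    -- the ranked sequence of `X` is almost surely well defined, and it has a law
    (∀ᵐ ω ∂P, (X ω).1.HasAsymptoticFreqs ∧ (X ω).1.IsRanking (X ω).1.ranked) ∧
    AEMeasurable (fun ω => (X ω).1.ranked) P ∧
    -- the law of `X` is a mixture of paintbox laws, with a unique mixing probability measure,
    -- which is the law of the ranked sequence of `X`
    ∃ ν : Measure RankedSeq,
      (IsProbabilityMeasure ν ∧ P.map X = ν.bind RankedSeq.paintboxLaw) ∧
      (∀ ν' : Measure RankedSeq,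
        IsProbabilityMeasure ν' → P.map X = ν'.bind RankedSeq.paintboxLaw → ν' = ν) ∧
      ν = P.map (fun ω => (X ω).1.ranked) := by
  have hr : Measurable fun x : NonDegPartition => x.1.ranked := InvariantLaw.measurable_ranked
  have : IsProbabilityMeasure (P.map X) := Measure.isProbabilityMeasure_map hX.aemeasurable
  have hinv : InvariantLaw (P.map X) := by
    intro σ hσ
    rw [Measure.map_map (NonDegPartition.measurable_act σ) hX]
    exact hexch σ hσ
  have hmap : (P.map X).map (fun x : NonDegPartition => x.1.ranked) =
      P.map fun ω => (X ω).1.ranked := Measure.map_map hr hX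
  refine ⟨RankedSeq.measurable_paintboxLaw, ?_, (hr.comp hX).aemeasurable, _,
    ⟨?_, ?_⟩, ?_, rfl⟩
  · filter_upwards [ae_of_ae_map hX.aemeasurable hinv.ae_hasAsymptoticFreqs] with ω hω
    exact ⟨hω, MarkedPartition.isRanking_ranked hω⟩
  · exact Measure.isProbabilityMeasure_map (hr.comp hX).aemeasurable
  · rw [← hmap]
    exact hinv.eq_bind_paintboxLaw
  · intro ν' _ h
    -- The ranking pushes the mixture directed by `ν'` forward to `ν'` itself.
    rw [← hmap, h, map_ranked_bind_paintboxLaw]
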